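/- Let $d\ge 1$ and consider the infinite chain with sites $\mathbb Z$ and local Hilbert space $\mathbb C^d$. Let $\mathcal B$ be the space of operators on $\mathbb C^d$ and $\mathcal B_0\subset\mathcal B$ the traceless ones. A formal operator is a family $\Phi=(\Phi(A))_A$, written $\Phi=\sum_A\Phi(A)$, indexed by the finite sets $A\subset\mathbb Z$, with $\Phi(A)\in\mathcal B_0^{\otimes A}$ (and $\Phi(\emptyset)\in\mathbb C$). For formal operators $\Phi,\Psi$, where $\Phi$ has finite range (i.e. $\max A-\min A$ is bounded over the nonempty sets $A$ with $\Phi(A)\ne0$), the commutator is defined by $[\Phi,\Psi](A)=\big[\sum_{C\subset B}\Phi(C),\sum_{C'\subset B}\Psi(C')\big]_A$ for any sufficiently large finite $B\supset A$, where $Y_A$ is the component of $Y$ in $\mathcal B_0^{\otimes A}$ under $\mathcal B^{\otimes B}=\bigoplus_{A\subset B}\mathcal B_0^{\otimes A}$. Let $H=\sum_{i\in\mathbb Z}h^{(2)}_i+\sum_{i\in\mathbb Z}h^{(1)}_i$ be a Hermitian, translation invariant Hamiltonian with $h^{(2)}_i\in\mathcal B_0\otimes\mathcal B_0$ acting on the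 sites $i,i+1$ and $h^{(1)}_i\in\mathcal B_0$ acting on the site $i$. Let $C$ be an arbitrary translation invariant, at most one-local operator (a sum of one-site operators $c_i$, possibly zero, possibly plus a constant), and define the boost operator $B_H=\sum_{j\in\mathbb Z}j\,(h^{(2)}_j+h^{(1)}_j)+C$. Set $Q^{(2)}=H$ and $Q^{(n+1)}=[B_H,Q^{(n)}]$ for $n\ge2$. For a translation invariant formal operator $\Phi$, its finite-size version on the periodic chain of length $N$ is $\Phi_{[N]}=\Phi(\emptyset)+\sum_{x=0}^{N-1}\tau_{[N]}(x)\Big[\sum_{1\in A\subset\{1,\dots,N\}}\Phi(A)\Big]\tau_{[N]}(x)^\dagger$, where $\tau_{[N]}(x)$ is the cyclic translation by $x$ sites. Suppose that $[H_{[N_0]},Q^{(3)}_{[N_0]}]=0$ for some $N_0\ge6$. Then every $Q^{(n)}$, $n\ge2$, is translation invariant (so that its finite-size versions are defined), and $[Q^{(n)}_{[N]},Q^{(m)}_{[N]}]=0$ for all $N\ge4$ and all integers $n,m$ with $2\le n,m\le N/2$. In particular, $Q^{(n)}_{[N]}$ is a conserved quantity of $H_{[N]}$, i.e. $[H_{[N]},Q^{(n)}_{[N]}]=0$,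 for all $N\ge4$ and all $2\le n\le N/2$. -/

import Mathlib

namespace SpinChain

/-- Linear operators on the Hilbert space `(ℂ^d)^{⊗ S}` of a set `S` of sites, written as matrices
in the product basis, which is indexed by the configurations `S → Fin d`. -/
abbrev Op (d : ℕ) (S : Type) : Type := Matrix (S → Fin d) (S → Fin d) ℂ

open Classical in
/-- For an injective map of sites `f : S → T`, the operator on `T` that acts as `X` on the sites
`f(S)` (with `s` renamed to `f s`) and as the identity on all other sites. -/
noncomputable def transport {d : ℕ} {S T : Type} (f : S → T) (X : Op d S) : Op d T :=
  fun σ τ => if ∀ t, t ∉ Set.range f → σ t = τ t then X (σ ∘ f) (τ ∘ f) else 0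

/-- All partial traces of `X` over a single site vanish. On a finite set of sites this says that
`X` belongs to the tensor power, over the sites, of the space of traceless operators. -/
def SiteTraceless {d : ℕ} {S : Type} [DecidableEq S] (X : Op d S) : Prop :=
  ∀ (i : S) (σ τ : S → Fin d), ∑ a, X (Function.update σ i a) (Function.update τ i a) = 0

/-- Matrix elements of the map `Y ↦ Y - (tr Y / d) 1` on operators on `ℂ^d`. -/
noncomputable def tracelessKernel (d : ℕ) (s t s' t' : Fin d) : ℂ :=
  (if s' = s ∧ t' = t then 1 else 0) - (if s = t ∧ s' = t' then (d : ℂ)⁻¹ else 0)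

/-- Matrix elements of the functional `Y ↦ tr Y / d` on operators on `ℂ^d`. -/
noncomputable def traceKernel (d : ℕ) (s' t' : Fin d) : ℂ :=
  if s' = t' then (d : ℂ)⁻¹ else 0

/-- For `A ⊆ B` and an operator `Y` on `B`, the component `Y_A` of `Y` in the decomposition of the
operators on `B` as the direct sum, over the subsets `A` of `B`, of the operators that are traceless
at each site of `A` and the identity at each site of `B \ A`. It is obtained by applying
`Y ↦ Y - (tr Y / d) 1` at the sites of `A` and `Y ↦ tr Y / d` at the sites of `B \ A`. -/
noncomputable def component {d : ℕ} (A : Finset ℤ) {B : Finset ℤ} (Y : Op d B) : Op d A :=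
  fun σ τ => ∑ σ' : B → Fin d, ∑ τ' : B → Fin d,
    (∏ i : B, if h : (i : ℤ) ∈ A then tracelessKernel d (σ ⟨i, h⟩) (τ ⟨i, h⟩) (σ' i) (τ' i)
      else traceKernel d (σ' i) (τ' i)) * Y σ' τ'

lemma sum_tracelessKernel {d : ℕ} (s' t' : Fin d) : ∑ a, tracelessKernel d a a s' t' = 0 := by
  have hd : (d : ℂ) ≠ 0 := by
    have := s'.pos
    exact_mod_cast this.ne'
  by_cases h : s' = t'
  · subst h
    simp [tracelessKernel, hd]
  · have : ∀ a : Fin d, ¬ (s' = a ∧ t' = a) := fun a ha => h (ha.1.trans ha.2.symm)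
    simp [tracelessKernel, h, this]

lemma siteTraceless_component {d : ℕ} {A B : Finset ℤ} (hAB : A ⊆ B) (Y : Op d B) :
    SiteTraceless (component A Y) := by
  intro i σ τ
  simp only [component]
  rw [Finset.sum_comm]
  refine Finset.sum_eq_zero fun σ' _ => ?_
  rw [Finset.sum_comm]
  refine Finset.sum_eq_zero fun τ' _ => ?_
  rw [← Finset.sum_mul]
  refine mul_eq_zero_of_left ?_ _
  have hi : (⟨i, hAB i.2⟩ : B) ∈ (Finset.univ : Finset B) := Finset.mem_univ _
  simp only [← Finset.mul_prod_erase _ _ hi]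
  have hrest : ∀ a : Fin d, ∀ j ∈ Finset.univ.erase (⟨i, hAB i.2⟩ : B),
      (if h : (j : ℤ) ∈ A then tracelessKernel d (Function.update σ i a ⟨j, h⟩)
        (Function.update τ i a ⟨j, h⟩) (σ' j) (τ' j) else traceKernel d (σ' j) (τ' j)) =
      (if h : (j : ℤ) ∈ A then tracelessKernel d (σ ⟨j, h⟩) (τ ⟨j, h⟩) (σ' j) (τ' j)
        else traceKernel d (σ' j) (τ' j)) := by
    intro a j hj
    have hne : ∀ h : (j : ℤ) ∈ A, (⟨j, h⟩ : A) ≠ i := by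
      intro h he
      exact (Finset.mem_erase.1 hj).1 (Subtype.ext (congrArg (fun k : A => (k : ℤ)) he))
    by_cases h : (j : ℤ) ∈ A
    · simp [h, Function.update_of_ne (hne h)]
    · simp [h]
  simp only [Finset.prod_congr rfl (hrest _)]
  rw [← Finset.sum_mul]
  refine mul_eq_zero_of_left ?_ _
  simp [sum_tracelessKernel]

/-- A formal operator `Φ = ∑_A Φ(A)` on the infinite chain `ℤ` with local dimension `d`: a family
indexed by the finite sets `A` of sites, where `Φ(A)` is an operator on `A` that is traceless at
every site of `A`. -/
@[ext]
structure FormalOp (d : ℕ) where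
  /-- The term of the formal sum that is supported on `A`. -/
  term : (A : Finset ℤ) → Op d A
  siteTraceless : ∀ A, SiteTraceless (term A)

/-- The range `max A - min A + 1` of a finite set of sites, with value `0` for the empty set. -/
noncomputable def setRange (A : Finset ℤ) : ℕ :=
  if h : A.Nonempty then (A.max' h - A.min' h + 1).toNat else 0

/-- The translate `A + x`. -/
def shift (A : Finset ℤ) (x : ℤ) : Finset ℤ := A.image (· + x)

/-- The translation of sites `a ↦ a + x` as a map from `A` to `A + x`. -/
def shiftMap (A : Finset ℤ) (x : ℤ) (a : A) : shift A x :=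
  ⟨(a : ℤ) + x, Finset.mem_image_of_mem (· + x) a.2⟩

namespace FormalOp

variable {d : ℕ}

/-- The supremum of the ranges of the sets `A` with `Φ(A) ≠ 0`; only meaningful if these ranges are
bounded. -/
noncomputable def range (Φ : FormalOp d) : ℕ :=
  sSup {r | ∃ A, Φ.term A ≠ 0 ∧ setRange A = r}

/-- Self-adjointness. -/
def IsSelfAdjoint (Φ : FormalOp d) : Prop := ∀ A, (Φ.term A).IsHermitian

/-- Translation invariance: `Φ(A + x)` is the translate of `Φ(A)` for all `A` and `x`. -/
def IsTranslationInvariant (Φ : FormalOp d) : Prop :=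
  ∀ (A : Finset ℤ) (x : ℤ), Φ.term (shift A x) = transport (shiftMap A x) (Φ.term A)

/-- `Φ` consists of nearest-neighbour interactions and on-site potentials only. -/
def IsNearestNeighbor (Φ : FormalOp d) : Prop :=
  ∀ A, Φ.term A ≠ 0 → ∃ i : ℤ, A = {i} ∨ A = {i, i + 1}

/-- `Φ` is at most one-local: a sum of one-site operators (and possibly a constant). -/
def IsOneLocal (Φ : FormalOp d) : Prop := ∀ A, Φ.term A ≠ 0 → setRange A ≤ 1

/-- The restriction `∑_{A ⊆ B} Φ(A)` of `Φ` to a finite set `B` of sites, an operator on `B`. -/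
noncomputable def restrict (Φ : FormalOp d) (B : Finset ℤ) : Op d B :=
  ∑ A ∈ B.powerset.attach,
    transport (fun a : A.1 => (⟨a, Finset.mem_powerset.1 A.2 a.2⟩ : B)) (Φ.term A.1)

end FormalOp

/-- The set of all sites at distance at most `r` from `A`. -/
noncomputable def thicken (A : Finset ℤ) (r : ℕ) : Finset ℤ :=
  A.biUnion fun a => Finset.Icc (a - r) (a + r)

lemma subset_thicken (A : Finset ℤ) (r : ℕ) : A ⊆ thicken A r := by
  intro a ha
  simp only [thicken, Finset.mem_biUnion, Finset.mem_Icc]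
  exact ⟨a, ha, by omega, by omega⟩

namespace FormalOp

variable {d : ℕ}

/-- The commutator `[Φ, Ψ]` of formal operators, for `Φ` of finite range: `[Φ, Ψ](A)` is the
component on `A` of the commutator of the restrictions of `Φ` and `Ψ` to a large finite set `B ⊇ A`.
The component on `A` of `[Φ(C), Ψ(C')]` vanishes unless `C` meets `A` and `C' ⊆ A ∪ C`, so every `B`
that contains all sites at distance at most `r(Φ)` from `A` gives the same value; the smallest such
`B` is used. -/
noncomputable def comm (Φ Ψ : FormalOp d) : FormalOp d where
  term A := component A ⁅Φ.restrict (thicken A Φ.range), Ψ.restrict (thicken A Φ.range)⁆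
  siteTraceless A := siteTraceless_component (subset_thicken A Φ.range) _

open Classical in
/-- The boost operator `∑_j j (h²_j + h¹_j) + C` of a nearest-neighbour Hamiltonian
`H = ∑_j (h²_j + h¹_j)`, where `h²_j` acts on the sites `j, j + 1` and `h¹_j` on the site `j`: the
term of `H` supported on `A` is multiplied by the left-most site of `A`. -/
noncomputable def boost (H C : FormalOp d) : FormalOp d where
  term A := (if h : A.Nonempty then ((A.min' h : ℤ) : ℂ) else 0) • H.term A + C.term A
  siteTraceless A i σ τ := by
    have h1 := H.siteTraceless A i σ τ
    have h2 := C.siteTraceless A i σ τ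
    simp only [Matrix.add_apply, Matrix.smul_apply, smul_eq_mul, Finset.sum_add_distrib,
      ← Finset.mul_sum, h1, h2, mul_zero, add_zero]

/-- The charges `Q^(n)`, `n ≥ 2`: `Q^(2) = H` and `Q^(n+1) = [B, Q^(n)]` with the boost operator
`B` of `H`. -/
noncomputable def charge (H C : FormalOp d) (n : ℕ) : FormalOp d :=
  (fun Q => (boost H C).comm Q)^[n - 2] H

/-- The finite-size version `Φ_[N]` of a translation invariant formal operator `Φ` on the periodic
chain with `N` sites: the constant term of `Φ`, plus the sum of the `N` cyclic translates of
`∑ Φ(A)`, where `A` runs over the subsets of `{1, …, N}` that contain `1`. -/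
noncomputable def finiteSize (N : ℕ) [NeZero N] (Φ : FormalOp d) : Op d (ZMod N) :=
  transport (fun a : (∅ : Finset ℤ) => ((a : ℤ) : ZMod N)) (Φ.term ∅) +
    ∑ x : ZMod N, ∑ A ∈ (Finset.Icc (1 : ℤ) N).powerset with (1 : ℤ) ∈ A,
      transport (fun a : A => ((a : ℤ) : ZMod N) + x) (Φ.term A)

end FormalOp

end SpinChain


/-!
Expand every operator in products of one-site clock-and-shift matrices. A formal operator then
becomes a function on finitely supported strings of labels, and the bracket of two basis products is
a scalar multiple of the basis product of the sum of their strings. The scalar vanishes unless the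
strings meet, and it depends only on the labels at the common sites. So finite-range functions
form a Lie algebra, and `Φ ↦ Φ_[N]` respects the bracket of functions of ranges `n` and `m` whenever
`n + m ≤ N + 1`, since then wrapped strings meet at most as unwrapped ones do.

Put `h = H`, `b = B_H`. In `[h, [b, h]]` the interactions of range `4` cancel, so this bracket has
range `3` and a ring of length `N₀` detects whether it vanishes. Granted this, the Jacobi identity
turns `[h, q] = 0` into `[h, [h, [b, q]]] = 0`. On a ring `h` is Hermitian, hence diagonalisable, so
`[h, [b, q]] = 0`. Hence every `Q⁽ⁿ⁾` commutes with `h`, and any two commute by Jacobi again.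
-/

namespace SpinChain

attribute [local instance] LieRing.ofAssociativeRing

section OneSite

variable {d : ℕ}

/-- Labels of the clock-and-shift basis of the operators on `ℂ^d`: the power of the shift matrix,
then the power of the clock matrix. -/
abbrev Label (d : ℕ) : Type := Fin d × Fin d

variable [NeZero d]

/-- The bicharacter `(b, t) ↦ exp (2πi b t / d)` of `ℤ/d`. -/
noncomputable def rootChar (b t : Fin d) : ℂ :=
  ZMod.stdAddChar (ZMod.finEquiv d b * ZMod.finEquiv d t)

lemma rootChar_comm (b t : Fin d) : rootChar b t = rootChar t b := by
  rw [rootChar, rootChar, mul_comm]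

lemma rootChar_add_left (b c t : Fin d) : rootChar (b + c) t = rootChar b t * rootChar c t := by
  rw [rootChar, map_add, add_mul, AddChar.map_add_eq_mul, rootChar, rootChar]

lemma rootChar_add_right (b c t : Fin d) : rootChar t (b + c) = rootChar t b * rootChar t c := by
  rw [rootChar_comm, rootChar_add_left, rootChar_comm b, rootChar_comm c]

@[simp] lemma rootChar_zero_left (t : Fin d) : rootChar 0 t = 1 := by simp [rootChar]

@[simp] lemma rootChar_zero_right (t : Fin d) : rootChar t 0 = 1 := by simp [rootChar]

lemma rootChar_neg_left (b t : Fin d) : rootChar (-b) t = rootChar b (-t) := by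
  simp [rootChar]

lemma sum_rootChar (b : Fin d) : ∑ t, rootChar b t = if b = 0 then (d : ℂ) else 0 := by
  have hsum := AddChar.sum_mulShift (ZMod.finEquiv d b) (ZMod.isPrimitive_stdAddChar d)
  rw [← (ZMod.finEquiv d).toEquiv.sum_comp] at hsum
  simpa [rootChar, mul_comm, ZMod.card] using hsum

/-- The clock-and-shift basis of the operators on one site. -/
noncomputable def site (α : Label d) (s t : Fin d) : ℂ :=
  if s = t + α.1 then rootChar α.2 t else 0

/-- The basis dual to `site`. -/
noncomputable def dualSite (α : Label d) (s t : Fin d) : ℂ :=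
  if s = t + α.1 then rootChar (-α.2) t / d else 0

lemma site_zero (s t : Fin d) : site (0 : Label d) s t = if s = t then 1 else 0 := by
  simp [site]

lemma dualSite_zero (s t : Fin d) : dualSite (0 : Label d) s t = traceKernel d s t := by
  simp [dualSite, traceKernel]

lemma sum_site_mul_site (α β : Label d) (s t : Fin d) :
    ∑ u, site α s u * site β u t = rootChar α.2 β.1 * site (α + β) s t := by
  simp only [site, mul_ite, mul_zero, Finset.sum_ite_eq', Finset.mem_univ, if_true, Prod.fst_add,
    Prod.snd_add, rootChar_add_left, rootChar_add_right, add_assoc, add_comm β.1]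
  split_ifs <;> ring

lemma sum_dualSite_mul_site (α β : Label d) :
    ∑ s, ∑ t, dualSite α s t * site β s t = if α = β then 1 else 0 := by
  have hcol (t : Fin d) : ∑ s, dualSite α s t * site β s t =
      if α.1 = β.1 then rootChar (-α.2 + β.2) t / d else 0 := by
    simp only [dualSite, site, ite_mul, zero_mul, Finset.sum_ite_eq', Finset.mem_univ, if_true,
      add_right_inj, mul_ite, mul_zero, rootChar_add_left, eq_comm (a := β.1)]
    split_ifs <;> ring
  rw [Finset.sum_comm]
  simp only [hcol]
  by_cases h1 : α.1 = β.1 <;>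
    simp [h1, ← Finset.sum_div, sum_rootChar, neg_add_eq_zero, Prod.ext_iff, ite_div]

lemma sum_site_mul_dualSite (s t s' t' : Fin d) :
    ∑ α : Label d, site α s t * dualSite α s' t' = if s = s' ∧ t = t' then 1 else 0 := by
  have hterm (a b : Fin d) : site (a, b) s t * dualSite (a, b) s' t' =
      if a = s - t then (if s' = t' + (s - t) then rootChar (t - t') b / d else 0) else 0 := by
    simp only [site, dualSite, ← sub_eq_iff_eq_add', eq_comm (a := s - t), rootChar_neg_left,
      sub_eq_add_neg t t', rootChar_comm _ b, rootChar_add_right]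
    by_cases ha : a = s - t
    · subst ha
      split_ifs <;> ring
    · simp [ha]
  simp only [Fintype.sum_prod_type_right, hterm, Finset.sum_ite_eq', Finset.mem_univ, if_true]
  by_cases ht : t = t'
  · simp [ht, eq_comm]
  · simp [ht, sub_eq_zero, ← Finset.sum_div, sum_rootChar]

lemma sum_site_diag (α : Label d) : ∑ s, site α s s = if α = 0 then (d : ℂ) else 0 := by
  by_cases h1 : α.1 = 0 <;> simp [site, h1, sum_rootChar, Prod.ext_iff]

lemma sum_dualSite_mul_tracelessKernel {α : Label d} (hα : α ≠ 0) (s' t' : Fin d) :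
    ∑ s, ∑ t, dualSite α s t * tracelessKernel d s t s' t' = dualSite α s' t' := by
  have hsplit (s t : Fin d) : dualSite α s t * tracelessKernel d s t s' t' =
      (if s' = s then if t' = t then dualSite α s t else 0 else 0) -
        traceKernel d s' t' * (dualSite α s t * site 0 s t) := by
    simp only [tracelessKernel, traceKernel, site_zero]
    split_ifs <;> simp_all [sub_mul, mul_comm]
  simp only [hsplit, Finset.sum_sub_distrib, ← Finset.mul_sum, sum_dualSite_mul_site, if_neg hα,
    Finset.sum_ite_irrel, Finset.sum_ite_eq, Finset.mem_univ, if_true, Finset.sum_const_zero,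
    mul_zero, sub_zero]

end OneSite

section Phase

variable {ι κ : Type*} {d : ℕ} [NeZero d]

/-- The bicharacter that describes the products of basis operators, see `mon_mul_mon`. -/
noncomputable def phase (g h : ι →₀ Label d) : ℂ := g.prod fun i α => rootChar α.2 (h i).1

lemma phase_add_left (g g' h : ι →₀ Label d) : phase (g + g') h = phase g h * phase g' h := by
  classical
  exact Finsupp.prod_add_index' (by simp) fun i α β => rootChar_add_left _ _ _

lemma phase_add_right (g h h' : ι →₀ Label d) : phase g (h + h') = phase g h * phase g h' := by
  simp only [phase, Finsupp.add_apply, Prod.fst_add, rootChar_add_right, Finsupp.prod_mul]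

lemma phase_neg_left (g h : ι →₀ Label d) : phase (-g) h = phase g (-h) := by
  simp [phase, Finsupp.prod_neg_index, rootChar_neg_left]

lemma phase_eq_one {g h : ι →₀ Label d} (hd : ∀ i, g i = 0 ∨ h i = 0) : phase g h = 1 :=
  Finset.prod_eq_one fun i hi => by simp [(hd i).resolve_left (Finsupp.mem_support_iff.1 hi)]

lemma phase_eq_prod [Fintype ι] (g h : ι →₀ Label d) :
    phase g h = ∏ i, rootChar (g i).2 (h i).1 :=
  g.prod_fintype _ (by simp)

lemma mapDomain_apply_of_injective_at {M : Type*} [AddCommMonoid M] {f : ι → κ} {h : ι →₀ M} {i : ι}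
    (hf : ∀ j ∈ h.support, f i = f j → i = j) : h.mapDomain f (f i) = h i := by
  rw [Finsupp.mapDomain, Finsupp.sum_apply, Finsupp.sum, Finset.sum_eq_single i]
  · simp
  · intro j hj hji
    exact Finsupp.single_eq_of_ne fun e => hji (hf j hj e).symm
  · exact fun hi => by simp [Finsupp.notMem_support_iff.1 hi]

lemma phase_mapDomain {f : ι → κ} {g h : ι →₀ Label d}
    (hf : ∀ i ∈ g.support, ∀ j ∈ h.support, f i = f j → i = j) :
    phase (g.mapDomain f) (h.mapDomain f) = phase g h := by
  calc phase (g.mapDomain f) (h.mapDomain f)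
    _ = g.prod fun i α => rootChar α.2 (h.mapDomain f (f i)).1 := by
        unfold phase
        rw [Finsupp.prod_mapDomain_index]
        · simp
        · simp [rootChar_add_left]
    _ = phase g h :=
        Finset.prod_congr rfl fun i hi => by simp only [mapDomain_apply_of_injective_at (hf i hi)]

/-- The structure constants of the brackets of basis operators, see `lie_mon`. -/
noncomputable def lam (g h : ι →₀ Label d) : ℂ := phase g h - phase h g

lemma lam_swap (g h : ι →₀ Label d) : lam h g = -lam g h := by simp [lam]

lemma exists_of_lam_ne_zero {g h : ι →₀ Label d} (hgh : lam g h ≠ 0) : ∃ i, g i ≠ 0 ∧ h i ≠ 0 := by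
  contrapose! hgh
  have hd (i : ι) : g i = 0 ∨ h i = 0 := or_iff_not_imp_left.2 (hgh i)
  rw [lam, phase_eq_one hd, phase_eq_one fun i => (hd i).symm, sub_self]

lemma lam_sub_self (g k : ι →₀ Label d) : lam g (k - g) = phase g (-g) * lam g k := by
  rw [lam, lam, sub_eq_add_neg k g, phase_add_right, phase_add_left, phase_neg_left]
  ring

lemma exists_of_lam_sub_ne_zero {g k : ι →₀ Label d} (hgk : lam g (k - g) ≠ 0) :
    ∃ i, g i ≠ 0 ∧ k i ≠ 0 :=
  exists_of_lam_ne_zero (right_ne_zero_of_mul (lam_sub_self g k ▸ hgk))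

lemma lam_mapDomain {f : ι → κ} {g h : ι →₀ Label d}
    (hf : ∀ i ∈ g.support, ∀ j ∈ h.support, f i = f j → i = j) :
    lam (g.mapDomain f) (h.mapDomain f) = lam g h := by
  rw [lam, lam, phase_mapDomain hf, phase_mapDomain fun j hj i hi e => (hf i hi j hj e.symm).symm]

end Phase

section ProductBasis

variable {d : ℕ} {T : Type} [Fintype T]

lemma sum_sum_prod [DecidableEq T] (F : T → Fin d → Fin d → ℂ) :
    ∑ σ : T → Fin d, ∑ τ : T → Fin d, ∏ t, F t (σ t) (τ t) = ∏ t, ∑ a, ∑ b, F t a b := by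
  rw [Fintype.prod_sum]
  exact Finset.sum_congr rfl fun σ _ => (Fintype.prod_sum fun t b => F t (σ t) b).symm

variable [NeZero d]

/-- Products over the sites of the one-site basis operators. -/
noncomputable def mon (g : T →₀ Label d) : Op d T := fun σ τ => ∏ t, site (g t) (σ t) (τ t)

lemma mon_zero : mon (0 : T →₀ Label d) = 1 := by
  ext σ τ
  simp [mon, site_zero, Matrix.one_apply, Finset.prod_ite_zero, funext_iff]

variable [DecidableEq T]

/-- The coefficient of `mon g` in an operator. -/
noncomputable def symbol (g : T →₀ Label d) : Op d T →ₗ[ℂ] ℂ where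
  toFun X := ∑ σ, ∑ τ, (∏ t, dualSite (g t) (σ t) (τ t)) * X σ τ
  map_add' X Y := by simp [mul_add, Finset.sum_add_distrib]
  map_smul' c X := by simp [Finset.mul_sum, mul_left_comm]

lemma symbol_apply (g : T →₀ Label d) (X : Op d T) :
    symbol g X = ∑ σ, ∑ τ, (∏ t, dualSite (g t) (σ t) (τ t)) * X σ τ := rfl

lemma mon_mul_mon (g h : T →₀ Label d) : mon g * mon h = phase g h • mon (g + h) := by
  ext σ τ
  simp only [Matrix.mul_apply, mon, Matrix.smul_apply, smul_eq_mul, phase_eq_prod,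
    Finsupp.add_apply, ← Finset.prod_mul_distrib, ← sum_site_mul_site]
  rw [Fintype.prod_sum]

lemma lie_mon (g h : T →₀ Label d) : ⁅mon g, mon h⁆ = lam g h • mon (g + h) := by
  rw [Ring.lie_def, mon_mul_mon, mon_mul_mon, add_comm h, lam, sub_smul]

lemma symbol_mon (g h : T →₀ Label d) : symbol g (mon h) = if g = h then 1 else 0 := by
  simp only [symbol_apply, mon, ← Finset.prod_mul_distrib]
  rw [sum_sum_prod fun t a b => dualSite (g t) a b * site (h t) a b]
  simp [sum_dualSite_mul_site, Finset.prod_ite_zero, DFunLike.ext_iff]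

lemma sum_prod_dualSite_mul_mon (σ τ σ' τ' : T → Fin d) :
    ∑ g : T →₀ Label d, (∏ t, dualSite (g t) (σ' t) (τ' t)) * mon g σ τ =
      if σ = σ' ∧ τ = τ' then 1 else 0 := by
  have hprod := Fintype.prod_sum fun t α => site α (σ t) (τ t) * dualSite α (σ' t) (τ' t)
  rw [← Finsupp.equivFunOnFinite.sum_comp] at hprod
  simp only [sum_site_mul_dualSite, Finset.prod_ite_zero, Finset.prod_mul_distrib] at hprod
  simpa [mon, mul_comm, forall_and, funext_iff] using hprod.symm

lemma sum_symbol_smul_mon (X : Op d T) : ∑ g, symbol g X • mon g = X := by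
  ext σ τ
  calc (∑ g, symbol g X • mon g) σ τ
    _ = ∑ g, ∑ σ', ∑ τ', (∏ t, dualSite (g t) (σ' t) (τ' t)) * mon g σ τ * X σ' τ' := by
        simp only [Matrix.sum_apply, Matrix.smul_apply, smul_eq_mul, symbol_apply, Finset.sum_mul,
          mul_right_comm]
    _ = ∑ σ', ∑ τ', (∑ g, (∏ t, dualSite (g t) (σ' t) (τ' t)) * mon g σ τ) * X σ' τ' := by
        simp only [Finset.sum_mul]
        rw [Finset.sum_comm]
        exact Finset.sum_congr rfl fun _ _ => Finset.sum_comm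
    _ = X σ τ := by simp [sum_prod_dualSite_mul_mon, ite_and]

lemma symbol_lie (k : T →₀ Label d) (X Y : Op d T) :
    symbol k ⁅X, Y⁆ = ∑ g, lam g (k - g) * (symbol g X * symbol (k - g) Y) := by
  conv_lhs => rw [← sum_symbol_smul_mon X, ← sum_symbol_smul_mon Y, sum_lie_sum]
  simp only [smul_lie, lie_smul, lie_mon, map_sum, map_smul, symbol_mon, smul_eq_mul,
    ← sub_eq_iff_eq_add', mul_ite, mul_one, mul_zero, Finset.sum_ite_eq, Finset.mem_univ, if_true]
  exact Finset.sum_congr rfl fun g _ => by ring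

lemma sum_mon_update (h : T →₀ Label d) (i : T) (σ τ : T → Fin d) :
    site 0 (σ i) (τ i) * ∑ a, mon h (Function.update σ i a) (Function.update τ i a) =
      if h i = 0 then d * mon h σ τ else 0 := by
  have hsplit (a : Fin d) : mon h (Function.update σ i a) (Function.update τ i a) =
      site (h i) a a * ∏ t ∈ Finset.univ.erase i, site (h t) (σ t) (τ t) := by
    rw [mon, ← Finset.mul_prod_erase _ _ (Finset.mem_univ i)]
    congr 1
    · simp
    · exact Finset.prod_congr rfl fun t ht => by simp [Finset.ne_of_mem_erase ht]
  simp only [hsplit, ← Finset.sum_mul, sum_site_diag]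
  split_ifs with h0
  · rw [mon, ← Finset.mul_prod_erase _ _ (Finset.mem_univ i), h0]
    ring
  · simp

lemma symbol_eq_zero_of_siteTraceless {X : Op d T} (hX : SiteTraceless X) {g : T →₀ Label d}
    {i : T} (hi : g i = 0) : symbol g X = 0 := by
  have hpart : ∑ h, (if h i = 0 then symbol h X else 0) • mon h = 0 := by
    ext σ τ
    refine (mul_eq_zero.1 ?_).resolve_left (NeZero.ne (d : ℂ))
    calc d * (∑ h, (if h i = 0 then symbol h X else 0) • mon h) σ τ
      _ = ∑ h, symbol h X * if h i = 0 then d * mon h σ τ else 0 := by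
          simp only [Matrix.sum_apply, Matrix.smul_apply, Finset.mul_sum, smul_eq_mul, ite_mul,
            mul_ite, zero_mul, mul_zero, mul_left_comm]
      _ = site 0 (σ i) (τ i) * ∑ a,
            (∑ h, symbol h X • mon h) (Function.update σ i a) (Function.update τ i a) := by
          simp only [← sum_mon_update, Matrix.sum_apply, Matrix.smul_apply, smul_eq_mul]
          rw [Finset.sum_comm]
          simp only [Finset.mul_sum, mul_left_comm]
      _ = 0 := by rw [sum_symbol_smul_mon, hX i σ τ, mul_zero]
  have hg := congrArg (symbol g) hpart
  simpa only [map_sum, map_smul, symbol_mon, smul_eq_mul, mul_ite, mul_one, mul_zero,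
    Finset.sum_ite_eq, Finset.mem_univ, if_true, hi, map_zero] using hg

end ProductBasis

section Transport

variable {d : ℕ} {S T : Type}

/-- `transport` as a linear map. -/
noncomputable def transportLin (f : S → T) : Op d S →ₗ[ℂ] Op d T where
  toFun := transport f
  map_add' X Y := by
    ext σ τ; simp only [transport, Matrix.add_apply]; split_ifs <;> simp
  map_smul' c X := by
    ext σ τ; simp only [transport, Matrix.smul_apply, RingHom.id_apply]; split_ifs <;> simp

lemma transport_sum_smul {ι : Type*} (f : S → T) (s : Finset ι) (c : ι → ℂ) (X : ι → Op d S) :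
    transport f (∑ i ∈ s, c i • X i) = ∑ i ∈ s, c i • transport f (X i) := by
  change transportLin f _ = ∑ i ∈ s, c i • transportLin f (X i)
  simp only [map_sum, map_smul]

lemma transport_mon [NeZero d] [Fintype S] [Fintype T] {f : S → T} (hf : f.Injective)
    (g : S →₀ Label d) : transport f (mon g) = mon (g.mapDomain f) := by
  ext σ τ
  by_cases hστ : ∀ t, t ∉ Set.range f → σ t = τ t
  · rw [transport, if_pos hστ]
    refine Fintype.prod_of_injective f hf _ _ (fun t ht => ?_) fun s => ?_
    · rw [Finsupp.mapDomain_of_notMem_range _ _ ht, site_zero, if_pos (hστ t ht)]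
    · simp only [Finsupp.mapDomain_apply hf, Function.comp_apply]
  · rw [transport, if_neg hστ]
    push Not at hστ
    obtain ⟨t, ht, hne⟩ := hστ
    refine (Finset.prod_eq_zero (Finset.mem_univ t) ?_).symm
    rw [Finsupp.mapDomain_of_notMem_range _ _ ht, site_zero, if_neg hne]

end Transport

section Windows

variable {d : ℕ} {A W : Finset ℤ}

/-- Strings of labels along the chain. They label the products of one-site basis operators. -/
abbrev Str (d : ℕ) [NeZero d] : Type := ℤ →₀ Label d

variable [NeZero d]

/-- The part of a string that lies in a window. -/
noncomputable abbrev restr (W : Finset ℤ) (k : Str d) : W →₀ Label d := k.subtypeDomain (· ∈ W)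

/-- The strings that are supported in a window. -/
noncomputable def stringsIn (d : ℕ) [NeZero d] (W : Finset ℤ) : Finset (Str d) :=
  W.finsupp fun _ => Finset.univ

lemma mem_stringsIn {k : Str d} : k ∈ stringsIn d W ↔ k.support ⊆ W := by
  simp [stringsIn, Finset.mem_finsupp_iff]

lemma sum_restr {M : Type*} [AddCommMonoid M] (F : (W →₀ Label d) → M) :
    ∑ k ∈ stringsIn d W, F (restr W k) = ∑ g, F g :=
  Finset.sum_nbij' (restr W) Finsupp.extendDomain (fun _ _ => Finset.mem_univ _)
    (fun g _ => mem_stringsIn.2 fun _ hi => Finsupp.support_extendDomain_subset g hi)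
    (fun k hk => Finsupp.extendDomain_subtypeDomain k (mem_stringsIn.1 hk))
    (fun g _ => Finsupp.subtypeDomain_extendDomain g) fun _ _ => rfl

lemma restr_inj {k l : Str d} (hk : k.support ⊆ W) (hl : l.support ⊆ W) :
    restr W k = restr W l ↔ k = l := by
  refine ⟨fun e => ?_, fun e => e ▸ rfl⟩
  calc k
    _ = (restr W k).extendDomain := (Finsupp.extendDomain_subtypeDomain k hk).symm
    _ = (restr W l).extendDomain := by rw [e]
    _ = l := Finsupp.extendDomain_subtypeDomain l hl

lemma mapDomain_restr {κ : Type*} {k : Str d} (hk : k.support ⊆ A) (F : ℤ → κ) :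
    (restr A k).mapDomain (fun a : A => F a) = k.mapDomain F :=
  Finsupp.sum_subtypeDomain_index (h := fun a α => Finsupp.single (F a) α) hk

lemma mapDomain_restr_eq_restr {k : Str d} (hk : k.support ⊆ A) {f : A → W} {F : ℤ → ℤ}
    (hf : ∀ a, (f a : ℤ) = F a) : (restr A k).mapDomain f = restr W (k.mapDomain F) := by
  rw [← mapDomain_restr hk F, ← funext hf,
    show (fun a => (f a : ℤ)) = Subtype.val ∘ f from rfl, Finsupp.mapDomain_comp]
  ext1 i
  exact (Finsupp.mapDomain_apply Subtype.val_injective _ i).symm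

lemma lam_restr {g k : Str d} (hg : g.support ⊆ W) (hk : k.support ⊆ W) :
    lam (restr W g) (restr W k) = lam g k := by
  rw [← lam_mapDomain (f := fun i : W => (i : ℤ)) fun i _ j _ e => Subtype.ext e]
  rw [mapDomain_restr hg fun i => i, mapDomain_restr hk fun i => i]
  exact congrArg₂ lam Finsupp.mapDomain_id Finsupp.mapDomain_id

/-- The restriction to a window of the formal operator with coefficients `a`. -/
noncomputable def trunc (W : Finset ℤ) (a : Str d → ℂ) : Op d W :=
  ∑ k ∈ stringsIn d W, a k • mon (restr W k)

lemma symbol_trunc (a : Str d → ℂ) {k : Str d} (hk : k.support ⊆ W) :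
    symbol (restr W k) (trunc W a) = a k := by
  simp only [trunc, map_sum, map_smul, symbol_mon]
  rw [Finset.sum_eq_single_of_mem k (mem_stringsIn.2 hk) fun l hl hlk => ?_]
  · simp
  · simp [restr_inj hk (mem_stringsIn.1 hl), hlk.symm]

lemma trunc_symbol (X : Op d W) : trunc W (fun k => symbol (restr W k) X) = X := by
  rw [trunc, sum_restr fun g => symbol g X • mon g, sum_symbol_smul_mon]

end Windows

section Coefficients

variable {d : ℕ} {A W : Finset ℤ}

lemma prod_dite_mem {M : Type*} [CommMonoid M] (hAW : A ⊆ W) (F : A → M) (G : W → M) :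
    ∏ i : W, (if h : (i : ℤ) ∈ A then F ⟨i, h⟩ else G i) =
      (∏ a, F a) * ∏ i : W, if (i : ℤ) ∈ A then 1 else G i := by
  have hF : ∏ a, F a = ∏ i : W, if h : (i : ℤ) ∈ A then F ⟨i, h⟩ else 1 :=
    Fintype.prod_of_injective (fun a : A => (⟨a, hAW a.2⟩ : W))
      (fun a b e => Subtype.ext (congrArg (fun i : W => (i : ℤ)) e)) _ _
      (fun i hi => dif_neg fun h => hi ⟨⟨i, h⟩, rfl⟩) fun a => by simp
  rw [hF, ← Finset.prod_mul_distrib]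
  exact Finset.prod_congr rfl fun i _ => by split_ifs <;> simp

variable [NeZero d]

lemma sum_prod_dualSite_mul_kernel {k : Str d} (hk : k.support ⊆ W) (σ' τ' : W → Fin d) :
    ∑ σ : k.support → Fin d, ∑ τ : k.support → Fin d,
      (∏ a : k.support, dualSite (k a) (σ a) (τ a)) *
      (∏ i : W, if h : (i : ℤ) ∈ k.support
        then tracelessKernel d (σ ⟨i, h⟩) (τ ⟨i, h⟩) (σ' i) (τ' i)
        else traceKernel d (σ' i) (τ' i)) = ∏ i : W, dualSite (k i) (σ' i) (τ' i) := by
  calc _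
    _ = (∏ a : k.support, ∑ s, ∑ t, dualSite (k a) s t *
          tracelessKernel d s t (σ' ⟨a, hk a.2⟩) (τ' ⟨a, hk a.2⟩)) *
        ∏ i : W, if (i : ℤ) ∈ k.support then 1 else traceKernel d (σ' i) (τ' i) := by
      rw [← sum_sum_prod]
      simp only [Finset.sum_mul, Finset.prod_mul_distrib, mul_assoc]
      refine Finset.sum_congr rfl fun σ _ => Finset.sum_congr rfl fun τ _ => ?_
      rw [← prod_dite_mem hk fun a => tracelessKernel d (σ a) (τ a) (σ' ⟨a, hk a.2⟩)
        (τ' ⟨a, hk a.2⟩)]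
    _ = ∏ i : W, dualSite (k i) (σ' i) (τ' i) := by
      rw [Finset.prod_congr rfl fun a _ =>
        sum_dualSite_mul_tracelessKernel (Finsupp.mem_support_iff.1 a.2) _ _, ← prod_dite_mem hk]
      refine Finset.prod_congr rfl fun i _ => ?_
      split_ifs with h
      · rfl
      · rw [Finsupp.notMem_support_iff.1 h, dualSite_zero]

lemma symbol_component (X : Op d W) {k : Str d} (hk : k.support ⊆ W) :
    symbol (restr k.support k) (component k.support X) = symbol (restr W k) X := by
  simp only [symbol_apply, component, Finsupp.subtypeDomain_apply,
    ← sum_prod_dualSite_mul_kernel hk, Finset.mul_sum, Finset.sum_mul, mul_assoc]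
  rw [Finset.sum_comm_cycle]
  exact Finset.sum_congr rfl fun _ _ => Finset.sum_comm_cycle

namespace FormalOp

/-- The coefficients of a formal operator with respect to the products of basis operators. -/
noncomputable def coef (Φ : FormalOp d) (k : Str d) : ℂ :=
  symbol (restr k.support k) (Φ.term k.support)

lemma term_eq_sum (Φ : FormalOp d) (A : Finset ℤ) :
    Φ.term A = ∑ k ∈ stringsIn d A with k.support = A, Φ.coef k • mon (restr A k) := by
  conv_lhs => rw [← trunc_symbol (Φ.term A), trunc]
  rw [Finset.sum_filter]
  refine Finset.sum_congr rfl fun k hk => ?_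
  split_ifs with h
  · subst h
    rfl
  · obtain ⟨i, hiA, hik⟩ := Finset.exists_of_ssubset ((mem_stringsIn.1 hk).ssubset_of_ne h)
    rw [symbol_eq_zero_of_siteTraceless (Φ.siteTraceless A) (i := ⟨i, hiA⟩)
      (Finsupp.notMem_support_iff (f := k).1 hik), zero_smul]

lemma transport_term (Φ : FormalOp d) {T : Type} [Fintype T] {f : A → T}
    (hf : f.Injective) : transport f (Φ.term A) =
      ∑ k ∈ stringsIn d A with k.support = A, Φ.coef k • mon ((restr A k).mapDomain f) := by
  rw [Φ.term_eq_sum, transport_sum_smul]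
  simp only [transport_mon hf]

lemma restrict_eq_trunc (Φ : FormalOp d) (W : Finset ℤ) : Φ.restrict W = trunc W Φ.coef := by
  have hfib (A : Finset ℤ) (hAW : A ⊆ W) :
      transport (fun a : A => (⟨a, hAW a.2⟩ : W)) (Φ.term A) =
        ∑ k ∈ stringsIn d W with k.support = A, Φ.coef k • mon (restr W k) := by
    rw [Φ.transport_term (f := fun a : A => (⟨a, hAW a.2⟩ : W)) fun a b e =>
      Subtype.ext (congrArg (fun i : W => (i : ℤ)) e)]
    refine Finset.sum_congr (Finset.ext fun k => ?_) fun k hk => ?_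
    · simp only [Finset.mem_filter, mem_stringsIn, and_congr_left_iff]
      rintro rfl
      simpa using hAW
    · rw [mapDomain_restr_eq_restr (Finset.mem_filter.1 hk).2.subset (W := W) (F := id)
        fun _ => rfl, Finsupp.mapDomain_id]
  rw [trunc, ← Finset.sum_fiberwise_of_maps_to fun k hk =>
    Finset.mem_powerset.2 (mem_stringsIn.1 hk), restrict, ← Finset.sum_attach W.powerset]
  exact Finset.sum_congr rfl fun A _ => hfib A.1 (Finset.mem_powerset.1 A.2)

end FormalOp

end Coefficients

section Bracket

variable {d : ℕ} [NeZero d]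

/-- All sites of the string lie in a window of `r` consecutive sites. -/
def FitsIn (r : ℕ) (k : Str d) : Prop := ∀ i ∈ k.support, ∀ j ∈ k.support, j < i + r

/-- A function on strings is of range `r` if it only takes strings into account that fit into a
window of `r` consecutive sites. -/
def HasRange (r : ℕ) (a : Str d → ℂ) : Prop := ∀ k, a k ≠ 0 → FitsIn r k

/-- The bracket of formal operators in terms of their coefficients, see `coef_comm`. The sum is
finite if `a` is of finite range. -/
noncomputable def brk (a b : Str d → ℂ) (k : Str d) : ℂ :=
  ∑ᶠ g, lam g (k - g) * (a g * b (k - g))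

variable {r s : ℕ} {a b c : Str d → ℂ}

lemma FitsIn.mono {k : Str d} (hk : FitsIn r k) (hrs : r ≤ s) : FitsIn s k :=
  fun i hi j hj => by have := hk i hi j hj; omega

lemma FitsIn.add {g h : Str d} (hg : FitsIn r g) (hh : FitsIn s h) (hm : ∃ i, g i ≠ 0 ∧ h i ≠ 0) :
    FitsIn (r + s - 1) (g + h) := by
  obtain ⟨m, hmg, hmh⟩ := hm
  have hmg' := Finsupp.mem_support_iff.2 hmg
  have hmh' := Finsupp.mem_support_iff.2 hmh
  intro i hi j hj
  have hr := hg m hmg' m hmg'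
  rcases Finset.mem_union.1 (Finsupp.support_add hi) with hi | hi <;>
    rcases Finset.mem_union.1 (Finsupp.support_add hj) with hj | hj
  · have := hg i hi j hj; have := hh m hmh' m hmh'; omega
  · have := hg i hi m hmg'; have := hh m hmh' j hj; omega
  · have := hh i hi m hmh'; have := hg m hmg' j hj; omega
  · have := hh i hi j hj; omega

lemma FitsIn.support_subset {g k : Str d} (hg : FitsIn r g) (hm : ∃ i, g i ≠ 0 ∧ k i ≠ 0) :
    g.support ⊆ thicken k.support r := by
  obtain ⟨i, hig, hik⟩ := hm
  have hig := Finsupp.mem_support_iff.2 hig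
  refine fun j hj => Finset.mem_biUnion.2 ⟨i, Finsupp.mem_support_iff.2 hik, Finset.mem_Icc.2 ?_⟩
  have := hg i hig j hj
  have := hg j hj i hig
  omega

lemma thicken_mono {A W : Finset ℤ} (hAW : A ⊆ W) (r : ℕ) : thicken A r ⊆ thicken W r :=
  Finset.biUnion_subset_biUnion_of_subset_left _ hAW

lemma HasRange.mono (ha : HasRange r a) (hrs : r ≤ s) : HasRange s a :=
  fun k hk => (ha k hk).mono hrs

lemma HasRange.add (ha : HasRange r a) (hb : HasRange r b) : HasRange r (a + b) := by
  intro k hk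
  by_cases h0 : a k = 0
  · exact hb k fun h1 => hk (by simp [h0, h1])
  · exact ha k h0

lemma HasRange.neg (ha : HasRange r a) : HasRange r (-a) :=
  fun k hk => ha k fun h0 => hk (by simp [h0])

lemma exists_of_brk_ne_zero {k : Str d} (hk : brk a b k ≠ 0) :
    ∃ g h, g + h = k ∧ (∃ i, g i ≠ 0 ∧ h i ≠ 0) ∧ a g ≠ 0 ∧ b h ≠ 0 := by
  obtain ⟨g, hg⟩ := not_forall.1 fun h0 => hk (finsum_eq_zero_of_forall_eq_zero h0)
  have hab := right_ne_zero_of_mul hg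
  exact ⟨g, k - g, add_sub_cancel g k, exists_of_lam_ne_zero (left_ne_zero_of_mul hg),
    left_ne_zero_of_mul hab, right_ne_zero_of_mul hab⟩

lemma HasRange.brk (ha : HasRange r a) (hb : HasRange s b) : HasRange (r + s - 1) (brk a b) := by
  intro k hk
  obtain ⟨g, h, rfl, hm, hag, hbh⟩ := exists_of_brk_ne_zero hk
  exact (ha g hag).add (hb h hbh) hm

lemma brk_zero_apply (a b : Str d → ℂ) : brk a b 0 = 0 := by
  refine finsum_eq_zero_of_forall_eq_zero fun g => mul_eq_zero_of_left ?_ _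
  by_contra hg
  obtain ⟨i, -, hi⟩ := exists_of_lam_sub_ne_zero hg
  exact hi rfl

lemma HasRange.fitsIn_of_brk_summand_ne_zero (ha : HasRange r a) (hb : HasRange s b)
    {N : ℕ} (hrs : r + s ≤ N + 1) {k h : Str d} (hkh : lam (k - h) h * (a (k - h) * b h) ≠ 0) :
    FitsIn N k ∧ FitsIn N h ∧ ∃ i, k i ≠ 0 ∧ h i ≠ 0 := by
  have hlam := left_ne_zero_of_mul hkh
  have hag := ha _ (left_ne_zero_of_mul (right_ne_zero_of_mul hkh))
  have hbh := hb h (right_ne_zero_of_mul (right_ne_zero_of_mul hkh))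
  obtain ⟨i, hig, hih⟩ := exists_of_lam_ne_zero hlam
  have hk := hag.add hbh ⟨i, hig, hih⟩
  rw [sub_add_cancel] at hk
  have hn := hag i (Finsupp.mem_support_iff.2 hig) i (Finsupp.mem_support_iff.2 hig)
  rw [lam_swap h, neg_ne_zero] at hlam
  exact ⟨hk.mono (by omega), hbh.mono (by omega),
    (exists_of_lam_sub_ne_zero hlam).imp fun _ => And.symm⟩

lemma brk_swap (a b : Str d → ℂ) : brk b a = -brk a b := by
  funext k
  rw [Pi.neg_apply, brk, brk, ← finsum_neg_distrib, ← finsum_comp_equiv (Equiv.subLeft k)]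
  refine finsum_congr fun g => ?_
  simp only [Equiv.subLeft_apply, sub_sub_cancel, lam_swap g, neg_mul, mul_comm (a _)]

lemma brk_eq_symbol (ha : HasRange r a) {k : Str d} {W : Finset ℤ}
    (hW : thicken k.support r ⊆ W) {X : Op d W}
    (hX : ∀ g, g.support ⊆ thicken k.support r → symbol (restr W g) X = b g) :
    brk a b k = symbol (restr W k) ⁅trunc W a, X⁆ := by
  have hkW := (subset_thicken k.support r).trans hW
  have hmem {g : Str d} (hl : lam g (k - g) ≠ 0) (hag : a g ≠ 0) :
      g.support ⊆ thicken k.support r := (ha g hag).support_subset (exists_of_lam_sub_ne_zero hl)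
  rw [symbol_lie, ← sum_restr, brk, finsum_eq_sum_of_support_subset (s := stringsIn d W)]
  · refine Finset.sum_congr rfl fun g hg => ?_
    have hgW := mem_stringsIn.1 hg
    have hkg := Finsupp.support_sub.trans (Finset.union_subset hkW hgW)
    rw [← Finsupp.subtypeDomain_sub, lam_restr hgW hkg, symbol_trunc a hgW]
    by_cases hl : lam g (k - g) = 0
    · simp [hl]
    by_cases hag : a g = 0
    · simp [hag]
    rw [hX _ (Finsupp.support_sub.trans
      (Finset.union_subset (subset_thicken _ _) (hmem hl hag)))]
  · intro g hg
    exact mem_stringsIn.2 ((hmem (left_ne_zero_of_mul hg)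
      (left_ne_zero_of_mul (right_ne_zero_of_mul hg))).trans hW)

lemma brk_eq_symbol_trunc (ha : HasRange r a) {k : Str d} {W : Finset ℤ}
    (hW : thicken k.support r ⊆ W) :
    brk a b k = symbol (restr W k) ⁅trunc W a, trunc W b⁆ :=
  brk_eq_symbol ha hW fun _ hg => symbol_trunc b (hg.trans hW)

lemma brk_brk_eq_symbol (ha : HasRange r a) (hb : HasRange s b) {k : Str d} {W : Finset ℤ}
    (hW : thicken (thicken k.support r) s ⊆ W) :
    brk a (brk b c) k = symbol (restr W k) ⁅trunc W a, ⁅trunc W b, trunc W c⁆⁆ :=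
  brk_eq_symbol ha ((subset_thicken _ s).trans hW) fun _ hg =>
    (brk_eq_symbol_trunc hb ((thicken_mono hg s).trans hW)).symm

lemma brk_add (ha : HasRange r a) (b c : Str d → ℂ) : brk a (b + c) = brk a b + brk a c := by
  funext k
  have htrunc : trunc (thicken k.support r) (b + c) =
      trunc (thicken k.support r) b + trunc (thicken k.support r) c := by
    simp [trunc, add_smul, Finset.sum_add_distrib]
  simp only [Pi.add_apply, brk_eq_symbol_trunc ha subset_rfl, htrunc, lie_add, map_add]

lemma add_brk (a b : Str d → ℂ) (hc : HasRange r c) : brk (a + b) c = brk a c + brk b c := by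
  rw [brk_swap c, brk_add hc, neg_add, ← brk_swap, ← brk_swap]

lemma brk_leibniz (ha : HasRange r a) (hb : HasRange r b) (hc : HasRange r c) :
    brk a (brk b c) = brk (brk a b) c + brk b (brk a c) := by
  funext k
  rw [brk_swap c (brk a b), Pi.add_apply, Pi.neg_apply, brk_brk_eq_symbol ha hb subset_rfl,
    brk_brk_eq_symbol hb ha subset_rfl, brk_brk_eq_symbol hc ha subset_rfl, leibniz_lie,
    map_add, ← lie_skew, map_neg]

end Bracket

section FiniteRange

variable {d : ℕ} [NeZero d]

/-- The space of functions on strings that are of finite range. It is a Lie ring under `brk`. -/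
def finiteRange (d : ℕ) [NeZero d] : AddSubgroup (Str d → ℂ) where
  carrier := {a | ∃ r, HasRange r a}
  zero_mem' := ⟨0, fun _ hk => absurd rfl hk⟩
  add_mem' := by
    rintro a b ⟨r, ha⟩ ⟨s, hb⟩
    exact ⟨max r s, (ha.mono (le_max_left r s)).add (hb.mono (le_max_right r s))⟩
  neg_mem' := by
    rintro a ⟨r, ha⟩
    exact ⟨r, ha.neg⟩

noncomputable instance : Bracket (finiteRange d) (finiteRange d) where
  bracket a b := ⟨brk a b, let ⟨_, ha⟩ := a.2; let ⟨_, hb⟩ := b.2; ⟨_, ha.brk hb⟩⟩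

lemma finiteRange.coe_lie (a b : finiteRange d) : (⁅a, b⁆ : finiteRange d) = brk a.1 b :=
  rfl

noncomputable instance : LieRing (finiteRange d) where
  add_lie a b c := by
    obtain ⟨r, hc⟩ := c.2
    exact Subtype.ext (add_brk a.1 b hc)
  lie_add a b c := by
    obtain ⟨r, ha⟩ := a.2
    exact Subtype.ext (brk_add ha b c)
  lie_self a := Subtype.ext (self_eq_neg.1 (brk_swap (a : Str d → ℂ) a))
  leibniz_lie a b c := by
    obtain ⟨r, ha⟩ := a.2
    obtain ⟨s, hb⟩ := b.2
    obtain ⟨t, hc⟩ := c.2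
    exact Subtype.ext (brk_leibniz (r := r + s + t) (ha.mono (by omega)) (hb.mono (by omega))
      (hc.mono (by omega)))

end FiniteRange

section Translation

variable {d : ℕ} [NeZero d] {G : Type*} [AddGroup G]

/-- Translation of strings along the chain or along the ring. -/
noncomputable def translate (x : G) : (G →₀ Label d) ≃+ (G →₀ Label d) :=
  Finsupp.domCongr (Equiv.addRight x)

lemma translate_eq_mapDomain (x : G) (k : G →₀ Label d) :
    translate x k = k.mapDomain (· + x) := Finsupp.equivMapDomain_eq_mapDomain _ _

@[simp] lemma translate_apply (x : G) (k : G →₀ Label d) (i : G) :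
    translate x k i = k (i - x) := by
  simp [translate, sub_eq_add_neg]

lemma translate_translate (x y : G) (k : G →₀ Label d) :
    translate x (translate y k) = translate (y + x) k := by
  ext i : 1
  simp [sub_eq_add_neg, add_assoc]

lemma translate_zero (k : G →₀ Label d) : translate 0 k = k := by
  ext i : 1
  simp

lemma lam_translate (x : G) (g h : G →₀ Label d) :
    lam (translate x g) (translate x h) = lam g h := by
  rw [translate_eq_mapDomain, translate_eq_mapDomain]
  exact lam_mapDomain fun i _ j _ e => add_right_cancel e

lemma mem_shift {A : Finset ℤ} {x i : ℤ} : i ∈ shift A x ↔ i - x ∈ A := by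
  simp only [shift, Finset.mem_image, ← eq_sub_iff_add_eq, exists_eq_right]

lemma shift_neg_eq_iff {A W : Finset ℤ} {x : ℤ} : shift W (-x) = A ↔ W = shift A x := by
  refine ⟨?_, ?_⟩ <;> rintro rfl <;> ext i <;> simp [mem_shift]

lemma support_translate (x : ℤ) (k : Str d) : (translate x k).support = shift k.support x := by
  ext i
  simp [mem_shift]

/-- Translation invariance of a formal operator in terms of its coefficients. -/
def TransInv (a : Str d → ℂ) : Prop := ∀ x k, a (translate x k) = a k

lemma brk_translate (a b : Str d → ℂ) (x : ℤ) (k : Str d) :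
    brk a b (translate x k) =
      brk (fun g => a (translate x g)) (fun g => b (translate x g)) k := by
  rw [brk, brk, ← finsum_comp_equiv (translate x : Str d ≃+ Str d).toEquiv]
  simp only [AddEquiv.toEquiv_eq_coe, EquivLike.coe_coe, ← map_sub, lam_translate]

end Translation

namespace FormalOp

variable {d : ℕ} [NeZero d] {A : Finset ℤ} {r : ℕ}

lemma term_eq_trunc (Φ : FormalOp d) (A : Finset ℤ) :
    Φ.term A = trunc A fun k => if k.support = A then Φ.coef k else 0 := by
  simp only [term_eq_sum Φ A, trunc, Finset.sum_filter, ite_smul, zero_smul]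

lemma fitsIn_iff_setRange_le {k : Str d} : FitsIn r k ↔ setRange k.support ≤ r := by
  rcases k.support.eq_empty_or_nonempty with h0 | h0
  · simp [FitsIn, setRange, h0]
  rw [FitsIn, setRange, dif_pos h0]
  refine ⟨fun h => ?_, fun h i hi j hj => ?_⟩
  · have := h _ (k.support.min'_mem h0) _ (k.support.max'_mem h0)
    omega
  · have := k.support.min'_le i hi
    have := k.support.le_max' j hj
    omega

lemma exists_coef_ne_zero {Φ : FormalOp d} (hA : Φ.term A ≠ 0) :
    ∃ k : Str d, k.support = A ∧ Φ.coef k ≠ 0 := by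
  contrapose! hA
  rw [term_eq_sum]
  exact Finset.sum_eq_zero fun k hk => by rw [hA k (Finset.mem_filter.1 hk).2, zero_smul]

lemma hasRange_coef_iff {Φ : FormalOp d} :
    HasRange r Φ.coef ↔ ∀ A, Φ.term A ≠ 0 → setRange A ≤ r := by
  refine ⟨fun h A hA => ?_, fun h k hk => fitsIn_iff_setRange_le.2 (h _ fun h0 => hk ?_)⟩
  · obtain ⟨k, rfl, hk⟩ := exists_coef_ne_zero hA
    exact fitsIn_iff_setRange_le.1 (h k hk)
  · rw [coef, h0, map_zero]

lemma coef_comm {Φ : FormalOp d} (hΦ : HasRange r Φ.coef) (Ψ : FormalOp d) :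
    (Φ.comm Ψ).coef = brk Φ.coef Ψ.coef := by
  have hrange : HasRange Φ.range Φ.coef :=
    hasRange_coef_iff.2 fun A hA => le_csSup
      ⟨r, by rintro _ ⟨A, hA, rfl⟩; exact hasRange_coef_iff.1 hΦ A hA⟩ ⟨A, hA, rfl⟩
  funext k
  rw [coef, comm, symbol_component _ (subset_thicken _ _), restrict_eq_trunc, restrict_eq_trunc,
    brk_eq_symbol_trunc hrange subset_rfl]

lemma transport_shiftMap_trunc (A : Finset ℤ) (x : ℤ) (a : Str d → ℂ) :
    transport (shiftMap A x) (trunc A a) = trunc (shift A x) fun k => a (translate (-x) k) := by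
  have hinj : (shiftMap A x).Injective := fun a b e =>
    Subtype.ext (add_right_cancel (congrArg (fun i : shift A x => (i : ℤ)) e))
  rw [trunc, trunc, transport_sum_smul]
  refine Finset.sum_nbij' (translate x) (translate (-x)) (fun k hk => ?_) (fun k hk => ?_)
    (fun k _ => ?_) (fun k _ => ?_) fun k hk => ?_
  · rw [mem_stringsIn, support_translate]
    exact Finset.image_subset_image (mem_stringsIn.1 hk)
  · rw [mem_stringsIn, support_translate]
    exact (Finset.image_subset_image (mem_stringsIn.1 hk)).trans (shift_neg_eq_iff.2 rfl).subset
  · simp [translate_translate, translate_zero]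
  · simp [translate_translate, translate_zero]
  · rw [transport_mon hinj, mapDomain_restr_eq_restr (mem_stringsIn.1 hk) (F := (· + x))
      fun _ => rfl, ← translate_eq_mapDomain, translate_translate, add_neg_cancel, translate_zero]

lemma isTranslationInvariant_iff {Φ : FormalOp d} :
    Φ.IsTranslationInvariant ↔ TransInv Φ.coef := by
  refine ⟨fun h x k => ?_, fun h A x => ?_⟩
  · have hk := congrArg (symbol (restr _ (translate x k))) (h k.support x)
    rw [term_eq_trunc, term_eq_trunc, transport_shiftMap_trunc,
      symbol_trunc _ (support_translate x k).subset,
      symbol_trunc _ (support_translate x k).subset] at hk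
    simpa [support_translate, translate_translate, translate_zero] using hk
  · rw [term_eq_trunc, term_eq_trunc, transport_shiftMap_trunc]
    simp only [support_translate, shift_neg_eq_iff, h (-x) _]

end FormalOp

section LieRing

variable {L : Type*} [LieRing L]

lemma lie_lie_lie_eq_zero {h b q : L} (hq : ⁅h, q⁆ = 0) (hb : ⁅h, ⁅b, h⁆⁆ = 0) :
    ⁅h, ⁅h, ⁅b, q⁆⁆⁆ = 0 := by
  have hb' : ⁅h, ⁅h, b⁆⁆ = 0 := by rw [← lie_skew h b, lie_neg, hb, neg_zero]
  rw [leibniz_lie h b q, hq, lie_zero, add_zero, leibniz_lie, hb', hq, zero_lie, lie_zero, add_zero]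

lemma lie_eq_zero_of_forall_lie_zero {b : L} {Q : ℕ → L} (hQ : ∀ n, Q (n + 1) = ⁅b, Q n⁆)
    (h0 : ∀ n, ⁅Q 0, Q n⁆ = 0) (n m : ℕ) : ⁅Q n, Q m⁆ = 0 := by
  induction n generalizing m with
  | zero => exact h0 m
  | succ n ih =>
    have hleibniz := leibniz_lie b (Q n) (Q m)
    rwa [ih, lie_zero, ← hQ, ← hQ, ih, add_zero, eq_comm] at hleibniz

lemma sum_comp_add_one {M : Type*} [AddCommMonoid M] {I : Finset ℤ} {F : ℤ → M}
    (hF : ∀ x, F x ≠ 0 → x ∈ I ∧ x - 1 ∈ I) : ∑ x ∈ I, F (x + 1) = ∑ x ∈ I, F x := by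
  rw [← finsum_eq_sum_of_support_subset F fun x hx => (hF x hx).1,
    ← finsum_eq_sum_of_support_subset (fun x => F (x + 1)) fun x hx => by
      simpa using (hF (x + 1) hx).2]
  exact finsum_comp_equiv (Equiv.addRight (1 : ℤ))

variable {u : ℤ → L} {I : Finset ℤ}

lemma lie_sum_eq_add (hI : ∀ x, u x ≠ 0 → x ∈ I) (hu : ∀ x y, x + 1 < y → ⁅u x, u y⁆ = 0)
    (x : ℤ) : ⁅u x, ∑ y ∈ I, u y⁆ = ⁅u x, u (x - 1)⁆ + ⁅u x, u (x + 1)⁆ := by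
  have hfar (y : ℤ) (hy : ⁅u x, u y⁆ ≠ 0) : y = x - 1 ∨ y = x + 1 := by
    by_contra! hne
    rcases lt_trichotomy y x with hlt | rfl | hlt
    · exact hy (by rw [← lie_skew, hu y x (by omega), neg_zero])
    · exact hy (lie_self _)
    · exact hy (hu x y (by omega))
  rw [lie_sum, ← finsum_eq_sum_of_support_subset (fun y => ⁅u x, u y⁆) fun y hy => hI y fun h0 =>
    hy (by simp [h0]), finsum_eq_sum_of_support_subset (s := {x - 1, x + 1}) _ fun y hy => by
      simpa using hfar y hy, Finset.sum_pair (by omega)]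

/-- With `b = ∑ x • u x` and `h = ∑ u x`, the weights collapse in `⁅b, h⁆`, since neighbouring
weights differ by `1`. -/
lemma lie_sum_smul_sum (hI : ∀ x, u x ≠ 0 → x ∈ I) (hu : ∀ x y, x + 1 < y → ⁅u x, u y⁆ = 0) :
    ⁅∑ x ∈ I, x • u x, ∑ x ∈ I, u x⁆ = -∑ x ∈ I, ⁅u x, u (x + 1)⁆ := by
  have hshift := sum_comp_add_one (I := I) (F := fun x => x • ⁅u x, u (x - 1)⁆) fun x hx =>
    ⟨hI x fun h0 => hx (by simp [h0]), hI _ fun h0 => hx (by simp [h0])⟩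
  simp only [add_sub_cancel_right] at hshift
  simp only [sum_lie, smul_lie, lie_sum_eq_add hI hu, smul_add, Finset.sum_add_distrib, ← hshift]
  rw [← Finset.sum_add_distrib, ← Finset.sum_neg_distrib]
  refine Finset.sum_congr rfl fun x _ => ?_
  rw [← lie_skew (u x), add_smul, one_smul, smul_neg]
  abel

/-- The brackets of three different pieces telescope, by the Jacobi identity. -/
lemma lie_lie_sum_smul_sum (hI : ∀ x, u x ≠ 0 → x ∈ I)
    (hu : ∀ x y, x + 1 < y → ⁅u x, u y⁆ = 0) :
    ⁅∑ x ∈ I, u x, ⁅∑ x ∈ I, x • u x, ∑ x ∈ I, u x⁆⁆ =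
      -∑ x ∈ I, ⁅u x + u (x + 1), ⁅u x, u (x + 1)⁆⁆ := by
  set h := ∑ x ∈ I, u x
  let G (x : ℤ) : L := ⁅⁅u (x - 1), u x⁆, u (x + 1)⁆
  have hG : ∑ x ∈ I, G (x + 1) = ∑ x ∈ I, G x := sum_comp_add_one fun x hx =>
    ⟨hI x fun h0 => hx (by simp [G, h0]), hI _ fun h0 => hx (by simp [G, h0])⟩
  have hleft (x : ℤ) : ⁅h, u x⁆ = ⁅u (x - 1), u x⁆ + ⁅u (x + 1), u x⁆ := by
    rw [← lie_skew, lie_sum_eq_add hI hu, neg_add, lie_skew, lie_skew]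
  have hterm (x : ℤ) : ⁅h, ⁅u x, u (x + 1)⁆⁆ =
      G x - G (x + 1) + ⁅u x + u (x + 1), ⁅u x, u (x + 1)⁆⁆ := by
    have hnext : ⁅u x, ⁅u (x + 1 + 1), u (x + 1)⁆⁆ = -G (x + 1) := by
      rw [← lie_skew _ (u (x + 1)), lie_neg, leibniz_lie, hu x (x + 1 + 1) (by omega), lie_zero,
        add_zero]
      simp only [G, add_sub_cancel_right]
    rw [leibniz_lie, hleft, hleft, add_lie, lie_add, hnext, add_sub_cancel_right,
      ← lie_skew (u (x + 1)) (u x), neg_lie, lie_skew, add_lie]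
    abel
  rw [lie_sum_smul_sum hI hu, lie_neg, lie_sum]
  simp only [hterm, Finset.sum_add_distrib, Finset.sum_sub_distrib, hG, sub_self, zero_add]

end LieRing

section Boost

variable {d : ℕ} [NeZero d] {r : ℕ} {a b : Str d → ℂ} {S T : Finset ℤ}

/-- The left-most site of a string, with value `0` for the trivial string. -/
noncomputable def leftmost (k : Str d) : ℤ :=
  if h : k.support.Nonempty then k.support.min' h else 0

lemma leftmost_mem {k : Str d} (hk : k ≠ 0) : leftmost k ∈ k.support := by
  rw [leftmost, dif_pos (Finsupp.support_nonempty_iff.2 hk)]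
  exact Finset.min'_mem _ _

lemma leftmost_le {k : Str d} {i : ℤ} (hi : i ∈ k.support) : leftmost k ≤ i := by
  rw [leftmost, dif_pos ⟨i, hi⟩]
  exact Finset.min'_le _ _ hi

lemma leftmost_translate (x : ℤ) {k : Str d} (hk : k ≠ 0) :
    leftmost (translate x k) = leftmost k + x := by
  have hmem := leftmost_mem ((translate x).map_ne_zero_iff.2 hk)
  rw [support_translate, mem_shift] at hmem
  refine le_antisymm (leftmost_le ?_) (by linarith [leftmost_le hmem])
  rw [support_translate, mem_shift, add_sub_cancel_right]
  exact leftmost_mem hk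

/-- The function only takes strings on the sites `S` into account. -/
def SupportedIn (S : Finset ℤ) (a : Str d → ℂ) : Prop := ∀ k, a k ≠ 0 → k.support ⊆ S

lemma SupportedIn.mono (ha : SupportedIn S a) (hST : S ⊆ T) : SupportedIn T a :=
  fun k hk => (ha k hk).trans hST

lemma SupportedIn.add (ha : SupportedIn S a) (hb : SupportedIn S b) : SupportedIn S (a + b) := by
  intro k hk
  by_cases h0 : a k = 0
  · exact hb k fun h1 => hk (by simp [h0, h1])
  · exact ha k h0

lemma SupportedIn.brk (ha : SupportedIn S a) (hb : SupportedIn S b) : SupportedIn S (brk a b) := by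
  intro k hk
  obtain ⟨g, h, rfl, -, hg, hh⟩ := exists_of_brk_ne_zero hk
  exact Finsupp.support_add.trans (Finset.union_subset (ha g hg) (hb h hh))

lemma SupportedIn.brk_eq_zero (ha : SupportedIn S a) (hb : SupportedIn T b) (hST : Disjoint S T) :
    SpinChain.brk a b = 0 := by
  funext k
  by_contra hk
  obtain ⟨g, h, -, ⟨i, hgi, hhi⟩, hg, hh⟩ := exists_of_brk_ne_zero hk
  exact Finset.disjoint_left.1 hST (ha g hg (Finsupp.mem_support_iff.2 hgi))
    (hb h hh (Finsupp.mem_support_iff.2 hhi))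

lemma SupportedIn.hasRange {x : ℤ} (ha : SupportedIn (Finset.Icc x (x + r)) a) :
    HasRange (r + 1) a := by
  intro k hk i hi j hj
  have := Finset.mem_Icc.1 (ha k hk hi)
  have := Finset.mem_Icc.1 (ha k hk hj)
  push_cast
  omega

lemma HasRange.sum {ι : Type*} {I : Finset ι} {F : ι → Str d → ℂ}
    (hF : ∀ x ∈ I, HasRange r (F x)) : HasRange r (∑ x ∈ I, F x) := by
  intro k hk
  rw [Finset.sum_apply] at hk
  obtain ⟨x, hx, hxk⟩ := Finset.exists_ne_zero_of_sum_ne_zero hk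
  exact hF x hx k hxk

/-- The part of `a` on the strings that start at the site `x`. -/
noncomputable def startingAt (a : Str d → ℂ) (x : ℤ) (k : Str d) : ℂ :=
  if leftmost k = x then a k else 0

lemma HasRange.supportedIn_startingAt (ha : HasRange (r + 1) a) (x : ℤ) :
    SupportedIn (Finset.Icc x (x + r)) (startingAt a x) := by
  intro k hk i hi
  obtain ⟨rfl, hak⟩ : leftmost k = x ∧ a k ≠ 0 := by simpa [startingAt] using hk
  have hk0 : k ≠ 0 := Finsupp.support_nonempty_iff.1 ⟨i, hi⟩
  have := ha k hak _ (leftmost_mem hk0) i hi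
  exact Finset.mem_Icc.2 ⟨leftmost_le hi, by push_cast at this; omega⟩

lemma sum_startingAt {I : Finset ℤ} (hI : ∀ k, a k ≠ 0 → leftmost k ∈ I) (w : ℤ → ℤ) :
    ∑ x ∈ I, w x • startingAt a x = fun k => (w (leftmost k) : ℂ) * a k := by
  funext k
  have hterm (x : ℤ) : w x • startingAt a x k =
      if leftmost k = x then (w (leftmost k) : ℂ) * a k else 0 := by
    rw [startingAt]
    split_ifs with hx <;> simp [hx]
  simp only [Finset.sum_apply, Pi.smul_apply, hterm, Finset.sum_ite_eq]
  exact ite_eq_left_iff.2 fun hk => by rw [not_imp_comm.1 (hI k) hk, mul_zero]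

/-- The pieces of `⁅h, ⁅b, h⁆⁆` that survive in `lie_lie_sum_smul_sum` live on three sites. -/
lemma HasRange.brk_brk_leftmost_mul_of_finite {I : Finset ℤ} (ha : HasRange 2 a)
    (hI : ∀ k, a k ≠ 0 → leftmost k ∈ I) :
    HasRange 3 (SpinChain.brk a (SpinChain.brk (fun k => leftmost k * a k) a)) := by
  have hS (x : ℤ) := ha.supportedIn_startingAt (r := 1) x
  let u (x : ℤ) : finiteRange d :=
    ⟨startingAt a x, 2, fun k hk => ha k fun h0 => hk (by simp [startingAt, h0])⟩
  have hu : ∀ x y, x + 1 < y → ⁅u x, u y⁆ = 0 := fun x y hxy =>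
    Subtype.ext ((hS x).brk_eq_zero (hS y) (Finset.disjoint_left.2 fun i hi hi' => by
      simp only [Finset.mem_Icc] at hi hi'; omega))
  have huI (x : ℤ) (hx : u x ≠ 0) : x ∈ I := by
    contrapose! hx
    refine Subtype.ext (funext fun k => ite_eq_right_iff.2 fun hk => ?_)
    exact not_imp_comm.1 (hI k) (hk ▸ hx)
  have hsum : ((∑ x ∈ I, u x : finiteRange d) : Str d → ℂ) = a := by
    simpa [u] using sum_startingAt hI fun _ => 1
  have hboost : ((∑ x ∈ I, x • u x : finiteRange d) : Str d → ℂ) =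
      fun k => leftmost k * a k := by
    simpa [u] using sum_startingAt hI fun x => x
  have hlie := congrArg Subtype.val (lie_lie_sum_smul_sum huI hu)
  rw [finiteRange.coe_lie, finiteRange.coe_lie, hsum, hboost] at hlie
  rw [hlie, AddSubgroup.coe_neg, AddSubgroup.val_finsetSum]
  refine (HasRange.sum fun x _ => SupportedIn.hasRange (x := x) ?_).neg
  have h0 : SupportedIn (Finset.Icc x (x + 2)) (startingAt a x) :=
    (hS x).mono (Finset.Icc_subset_Icc le_rfl (by omega))
  have h1 : SupportedIn (Finset.Icc x (x + 2)) (startingAt a (x + 1)) :=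
    (hS (x + 1)).mono (Finset.Icc_subset_Icc (by omega) (by push_cast; omega))
  exact (h0.add h1).brk (h0.brk h1)

lemma HasRange.brk_brk_leftmost_mul (ha : HasRange 2 a) :
    HasRange 3 (SpinChain.brk a (SpinChain.brk (fun k => leftmost k * a k) a)) := by
  intro k hk
  set W := thicken (thicken k.support 2) 2
  let c (g : Str d) : ℂ := if g.support ⊆ W then a g else 0
  have hc : HasRange 2 c := fun g hg => ha g fun h0 => hg (by simp [c, h0])
  have hcI (g : Str d) (hg : c g ≠ 0) : leftmost g ∈ insert 0 W := by
    by_cases h0 : g = 0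
    · simp [h0, leftmost]
    · exact Finset.mem_insert_of_mem ((ite_ne_right_iff.1 hg).1 (leftmost_mem h0))
  have hmul {a : Str d → ℂ} (ha : HasRange 2 a) : HasRange 2 fun g => leftmost g * a g :=
    fun g hg => ha g (right_ne_zero_of_mul hg)
  have htrunc (w : Str d → ℂ) : trunc W (fun g => w g * a g) = trunc W fun g => w g * c g :=
    Finset.sum_congr rfl fun g hg => by simp only [c, if_pos (mem_stringsIn.1 hg)]
  have htrunc1 : trunc W a = trunc W c := by simpa using htrunc 1
  refine hc.brk_brk_leftmost_mul_of_finite hcI k ?_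
  rwa [brk_brk_eq_symbol hc (hmul hc) subset_rfl, ← htrunc, ← htrunc1,
    ← brk_brk_eq_symbol ha (hmul ha) subset_rfl]

end Boost

section Ring

variable {d : ℕ} [NeZero d] {N : ℕ}

/-- The string on the periodic chain that a string on the infinite chain winds up to. -/
noncomputable def wrap (N : ℕ) (k : Str d) : ZMod N →₀ Label d := k.mapDomain Int.cast

lemma wrap_add (g h : Str d) : wrap N (g + h) = wrap N g + wrap N h := Finsupp.mapDomain_add

lemma mapDomain_intCast_add (k : Str d) (x : ZMod N) :
    k.mapDomain (fun i : ℤ => (i : ZMod N) + x) = translate x (wrap N k) := by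
  rw [translate_eq_mapDomain, wrap, ← Finsupp.mapDomain_comp]
  rfl

lemma wrap_translate (t : ℤ) (k : Str d) :
    wrap N (translate t k) = translate (t : ZMod N) (wrap N k) := by
  rw [← mapDomain_intCast_add, wrap, translate_eq_mapDomain, ← Finsupp.mapDomain_comp]
  simp [Function.comp_def]

lemma exists_of_wrap_ne_zero {k : Str d} {z : ZMod N} (hz : wrap N k z ≠ 0) :
    ∃ i ∈ k.support, (i : ZMod N) = z := by
  classical
  exact Finset.mem_image.1 (Finsupp.mapDomain_support (Finsupp.mem_support_iff.2 hz))

lemma eq_of_intCast_eq {i j : ℤ} (hij : (i : ZMod N) = j) (h1 : i < j + N) (h2 : j < i + N) :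
    i = j := by
  refine sub_eq_zero.1 (Int.eq_zero_of_abs_lt_dvd ?_ (abs_lt.2 ⟨by omega, by omega⟩) (m := N))
  rw [← ZMod.intCast_zmod_eq_zero_iff_dvd, Int.cast_sub, hij, sub_self]

/-- At most one translate along the infinite chain, among those that wind up to a given translate
along the ring, meets `h`. -/
lemma sum_lam_wrap_smul [NeZero N] {M : Type*} [AddCommGroup M] [Module ℂ M] {n m : ℕ}
    {g h : Str d} (hg : FitsIn n g) (hh : FitsIn m h) (hnm : n + m ≤ N + 1) (F : ZMod N → M) :
    ∑ x, lam (translate x (wrap N g)) (wrap N h) • F x =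
      ∑ᶠ t : ℤ, lam (translate t g) h • F t := by
  let T := Finset.image₂ (· - ·) h.support g.support
  have hT {t : ℤ} : t ∈ T ↔ ∃ j ∈ h.support, ∃ i ∈ g.support, j - i = t := Finset.mem_image₂
  rw [finsum_eq_sum_of_support_subset (s := T)]
  · symm
    refine Finset.sum_of_injOn Int.cast ?_ (fun _ _ => Finset.mem_coe.2 (Finset.mem_univ _)) ?_ ?_
    · intro t ht t' ht' htt'
      obtain ⟨j, hj, i, hi, rfl⟩ := hT.1 ht
      obtain ⟨j', hj', i', hi', rfl⟩ := hT.1 ht'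
      have := hg i hi i' hi'
      have := hg i' hi' i hi
      have := hh j hj j' hj'
      have := hh j' hj' j hj
      exact eq_of_intCast_eq htt' (by omega) (by omega)
    · refine fun x _ hx => smul_eq_zero_of_left (by_contra fun hlam => hx ?_) _
      obtain ⟨z, hgz, hhz⟩ := exists_of_lam_ne_zero hlam
      rw [translate_apply] at hgz
      obtain ⟨i, hi, hiz⟩ := exists_of_wrap_ne_zero hgz
      obtain ⟨j, hj, hjz⟩ := exists_of_wrap_ne_zero hhz
      exact ⟨j - i, hT.2 ⟨j, hj, i, hi, rfl⟩, by simp [hiz, hjz]⟩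
    · intro t ht
      obtain ⟨j₀, hj₀, i₀, hi₀, rfl⟩ := hT.1 ht
      rw [← wrap_translate, wrap, wrap, lam_mapDomain]
      intro i hi j hj hij
      rw [support_translate, mem_shift] at hi
      have := hg _ hi i₀ hi₀
      have := hg i₀ hi₀ _ hi
      have := hh j hj j₀ hj₀
      have := hh j₀ hj₀ j hj
      exact eq_of_intCast_eq hij (by omega) (by omega)
  · intro t ht
    obtain ⟨j, hgj, hhj⟩ := exists_of_lam_ne_zero (left_ne_zero_of_smul ht)
    rw [translate_apply, ← Finsupp.mem_support_iff] at hgj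
    exact hT.2 ⟨j, Finsupp.mem_support_iff.2 hhj, j - t, hgj, sub_sub_cancel j t⟩

/-- The sum of the translates of a basis operator on the periodic chain. -/
noncomputable def orbitSum [NeZero N] (κ : ZMod N →₀ Label d) : Op d (ZMod N) :=
  ∑ x, mon (translate x κ)

lemma orbitSum_translate [NeZero N] (x : ZMod N) (κ : ZMod N →₀ Label d) :
    orbitSum (translate x κ) = orbitSum κ := by
  simp only [orbitSum, translate_translate]
  exact Equiv.sum_comp (Equiv.addLeft x) fun y => mon (translate y κ)

lemma lie_orbitSum [NeZero N] (κ κ' : ZMod N →₀ Label d) :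
    ⁅orbitSum κ, orbitSum κ'⁆ =
      ∑ x, lam (translate x κ) κ' • orbitSum (translate x κ + κ') := by
  have hinner (y : ZMod N) : ∑ x, ⁅mon (translate x κ), mon (translate y κ')⁆ =
      ∑ x, lam (translate x κ) κ' • mon (translate y (translate x κ + κ')) := by
    rw [← Equiv.sum_comp (Equiv.addRight y)]
    simp only [Equiv.coe_addRight, ← translate_translate, lie_mon, lam_translate, map_add]
  simp only [orbitSum, lie_sum, sum_lie, hinner, Finset.smul_sum]
  exact Finset.sum_comm

/-- The strings in `{1, …, N}` that start at the site `1`. They represent the translation orbits of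
the nontrivial strings that fit into `N` sites. -/
noncomputable def firstStrings (d N : ℕ) [NeZero d] : Finset (Str d) :=
  {k ∈ stringsIn d (Finset.Icc (1 : ℤ) N) | k 1 ≠ 0}

lemma mem_firstStrings {k : Str d} :
    k ∈ firstStrings d N ↔ k.support ⊆ Finset.Icc (1 : ℤ) N ∧ k 1 ≠ 0 := by
  rw [firstStrings, Finset.mem_filter, mem_stringsIn]

lemma ne_zero_of_mem_firstStrings {k : Str d} (hk : k ∈ firstStrings d N) : k ≠ 0 := by
  rintro rfl
  exact (mem_firstStrings.1 hk).2 rfl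

lemma leftmost_of_mem_firstStrings {k : Str d} (hk : k ∈ firstStrings d N) : leftmost k = 1 :=
  le_antisymm (leftmost_le (Finsupp.mem_support_iff.2 (mem_firstStrings.1 hk).2))
    (Finset.mem_Icc.1 ((mem_firstStrings.1 hk).1
      (leftmost_mem (ne_zero_of_mem_firstStrings hk)))).1

lemma translate_mem_firstStrings {k : Str d} (hk0 : k ≠ 0) (hk : FitsIn N k) :
    translate (1 - leftmost k) k ∈ firstStrings d N := by
  refine mem_firstStrings.2 ⟨fun i hi => ?_, ?_⟩
  · rw [support_translate, mem_shift] at hi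
    have := leftmost_le hi
    have := hk _ (leftmost_mem hk0) _ hi
    exact Finset.mem_Icc.2 ⟨by omega, by omega⟩
  · simpa using leftmost_mem hk0

lemma finsum_eq_sum_firstStrings {M : Type*} [AddCommMonoid M] {F : Str d → M} (l : Str d)
    (hF : ∀ k, F k ≠ 0 → FitsIn N k ∧ ∃ i, k i ≠ 0 ∧ l i ≠ 0) :
    ∑ᶠ k, F k = ∑ k ∈ firstStrings d N, ∑ᶠ t : ℤ, F (translate t k) := by
  let e (p : firstStrings d N × ℤ) : Str d := translate p.2 p.1
  have hinj : e.Injective := by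
    rintro ⟨⟨g, hg⟩, s⟩ ⟨⟨k, hk⟩, t⟩ hgk
    have hleft := congrArg leftmost hgk
    simp only [e, leftmost_translate _ (ne_zero_of_mem_firstStrings hg),
      leftmost_translate _ (ne_zero_of_mem_firstStrings hk), leftmost_of_mem_firstStrings hg,
      leftmost_of_mem_firstStrings hk, add_right_inj] at hleft
    subst hleft
    simpa [e] using hgk
  have hrange : Function.support F ⊆ Set.range e := by
    intro k hk
    obtain ⟨hfit, i, hki, -⟩ := hF k hk
    have hk0 : k ≠ 0 := by rintro rfl; exact hki rfl
    exact ⟨(⟨_, translate_mem_firstStrings hk0 hfit⟩, leftmost k - 1), by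
      simp [e, translate_translate, translate_zero]⟩
  have hfinite : (Function.support F).Finite :=
    (stringsIn d (thicken l.support N)).finite_toSet.subset fun k hk =>
      mem_stringsIn.2 ((hF k hk).1.support_subset (hF k hk).2)
  calc ∑ᶠ k, F k
    _ = ∑ᶠ p, F (e p) := by
        rw [← finsum_mem_range hinj, ← finsum_mem_univ]
        exact finsum_mem_inter_support_eq' _ _ _ fun k hk => by simp [hrange hk]
    _ = ∑ᶠ k : firstStrings d N, ∑ᶠ t : ℤ, F (translate t k) :=
        finsum_curry _ (hfinite.preimage hinj.injOn)
    _ = ∑ k ∈ firstStrings d N, ∑ᶠ t : ℤ, F (translate t k) := by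
        rw [finsum_eq_sum_of_fintype]
        exact Finset.sum_coe_sort (firstStrings d N) fun k => ∑ᶠ t : ℤ, F (translate t k)

/-- Both sides sum `P` over the translation orbits of pairs of strings. -/
lemma sum_firstStrings_finsum_comm {M : Type*} [AddCommMonoid M] {P : Str d → Str d → M}
    (hP : ∀ t k h, P (translate t k) (translate t h) = P k h)
    (hfit : ∀ k h, P k h ≠ 0 → FitsIn N k ∧ FitsIn N h ∧ ∃ i, k i ≠ 0 ∧ h i ≠ 0) :
    ∑ h ∈ firstStrings d N, ∑ᶠ k, P k h = ∑ k ∈ firstStrings d N, ∑ᶠ h, P k h := by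
  calc ∑ h ∈ firstStrings d N, ∑ᶠ k, P k h
    _ = ∑ h ∈ firstStrings d N, ∑ k ∈ firstStrings d N, ∑ᶠ t : ℤ, P (translate t k) h :=
        Finset.sum_congr rfl fun h _ => finsum_eq_sum_firstStrings h fun k hk =>
          ⟨(hfit k h hk).1, (hfit k h hk).2.2⟩
    _ = ∑ k ∈ firstStrings d N, ∑ h ∈ firstStrings d N, ∑ᶠ t : ℤ, P k (translate t h) := by
        rw [Finset.sum_comm]
        refine Finset.sum_congr rfl fun k _ => Finset.sum_congr rfl fun h _ => ?_
        rw [← finsum_comp_equiv (Equiv.neg ℤ)]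
        refine finsum_congr fun t => ?_
        rw [← hP t, translate_translate, Equiv.neg_apply, neg_add_cancel, translate_zero]
    _ = ∑ k ∈ firstStrings d N, ∑ᶠ h, P k h :=
        Finset.sum_congr rfl fun k _ => (finsum_eq_sum_firstStrings k fun h hh =>
          ⟨(hfit k h hh).2.1, (hfit k h hh).2.2.imp fun _ => And.symm⟩).symm

end Ring

section RingOp

variable {d : ℕ} [NeZero d] {N : ℕ} [NeZero N] {r n m : ℕ} {a b : Str d → ℂ}

/-- The finite-size version of a formal operator in terms of its coefficients. -/
noncomputable def ringOp (N : ℕ) [NeZero N] (a : Str d → ℂ) : Op d (ZMod N) :=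
  a 0 • 1 + ∑ k ∈ firstStrings d N, a k • orbitSum (wrap N k)

lemma FormalOp.transport_term_translate (Φ : FormalOp d) {A : Finset ℤ}
    (hA : A ⊆ Finset.Icc (1 : ℤ) N) (x : ZMod N) :
    transport (fun a : A => ((a : ℤ) : ZMod N) + x) (Φ.term A) =
      ∑ k ∈ stringsIn d A with k.support = A, Φ.coef k • mon (translate x (wrap N k)) := by
  rw [Φ.transport_term (f := fun a : A => ((a : ℤ) : ZMod N) + x) fun i j hij => ?_]
  · refine Finset.sum_congr rfl fun k hk => ?_
    rw [mapDomain_restr (mem_stringsIn.1 (Finset.mem_filter.1 hk).1) fun i => (i : ZMod N) + x,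
      mapDomain_intCast_add]
  · have := Finset.mem_Icc.1 (hA i.2)
    have := Finset.mem_Icc.1 (hA j.2)
    exact Subtype.ext (eq_of_intCast_eq (add_right_cancel hij) (by omega) (by omega))

lemma FormalOp.finiteSize_eq_ringOp (Φ : FormalOp d) : Φ.finiteSize N = ringOp N Φ.coef := by
  have hempty : {k ∈ stringsIn d ∅ | k.support = ∅} = {0} := by
    ext k
    simp [mem_stringsIn]
  rw [finiteSize, ringOp]
  congr 1
  · have hterm := Φ.transport_term_translate (Finset.empty_subset (Finset.Icc 1 (N : ℤ))) 0
    rw [hempty, Finset.sum_singleton, wrap, Finsupp.mapDomain_zero, map_zero, mon_zero] at hterm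
    simpa only [add_zero] using hterm
  simp only [orbitSum, Finset.smul_sum]
  rw [Finset.sum_comm (s := firstStrings d N)]
  refine Finset.sum_congr rfl fun x _ => ?_
  rw [← Finset.sum_fiberwise_of_maps_to (s := firstStrings d N) (g := fun k => k.support)
    (t := {A ∈ (Finset.Icc (1 : ℤ) N).powerset | (1 : ℤ) ∈ A})
    fun k hk => Finset.mem_filter.2 ⟨Finset.mem_powerset.2 (mem_firstStrings.1 hk).1,
      Finsupp.mem_support_iff.2 (mem_firstStrings.1 hk).2⟩]
  refine Finset.sum_congr rfl fun A hA => ?_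
  rw [Finset.mem_filter, Finset.mem_powerset] at hA
  rw [Φ.transport_term_translate hA.1]
  refine Finset.sum_congr (Finset.ext fun k => ?_) fun _ _ => rfl
  simp only [Finset.mem_filter, mem_stringsIn, mem_firstStrings]
  refine and_congr_left fun hk => ?_
  subst hk
  exact iff_of_true subset_rfl ⟨hA.1, Finsupp.mem_support_iff.1 hA.2⟩

lemma translate_wrap_eq_wrap_iff {g k : Str d} (hg : g ∈ firstStrings d N)
    (hk : k ∈ firstStrings d N) (hgr : FitsIn r g) (hkr : FitsIn r k) (hr : 2 * r ≤ N + 1)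
    {x : ZMod N} : translate x (wrap N g) = wrap N k ↔ x = 0 ∧ g = k := by
  refine ⟨fun hx => ?_, by rintro ⟨rfl, rfl⟩; exact translate_zero _⟩
  have hwrap {k : Str d} (hk : k ∈ firstStrings d N) {i : ℤ} (hi : i ∈ Finset.Icc (1 : ℤ) N) :
      wrap N k i = k i := by
    refine mapDomain_apply_of_injective_at fun j hj hij => ?_
    have := Finset.mem_Icc.1 hi
    have := Finset.mem_Icc.1 ((mem_firstStrings.1 hk).1 hj)
    exact eq_of_intCast_eq hij (by omega) (by omega)
  have h1 : (1 : ℤ) ∈ Finset.Icc (1 : ℤ) N := Finset.mem_Icc.2 ⟨le_rfl, by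
    have := NeZero.one_le (n := N); omega⟩
  have hg1 := (mem_firstStrings.1 hg).2
  have hk1 := (mem_firstStrings.1 hk).2
  have hx0 : x = 0 := by
    obtain ⟨i, hi, hix⟩ : ∃ i ∈ g.support, (i : ZMod N) = (1 : ℤ) - x :=
      exists_of_wrap_ne_zero (by rwa [← translate_apply, hx, hwrap hk h1])
    obtain ⟨j, hj, hjx⟩ : ∃ j ∈ k.support, (j : ZMod N) = (1 : ℤ) + x :=
      exists_of_wrap_ne_zero (by rwa [← hx, translate_apply, add_sub_cancel_right, hwrap hg h1])
    have := Finset.mem_Icc.1 ((mem_firstStrings.1 hg).1 hi)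
    have := Finset.mem_Icc.1 ((mem_firstStrings.1 hk).1 hj)
    have := hgr 1 (Finsupp.mem_support_iff.2 hg1) i hi
    have := hkr 1 (Finsupp.mem_support_iff.2 hk1) j hj
    have hij : i + j = 2 := eq_of_intCast_eq (N := N) (by push_cast [hix, hjx]; ring) (by omega)
      (by omega)
    obtain rfl : j = 1 := by omega
    simpa using hjx
  subst hx0
  rw [translate_zero] at hx
  refine ⟨rfl, Finsupp.ext fun i => ?_⟩
  by_cases hi : i ∈ Finset.Icc (1 : ℤ) N
  · rw [← hwrap hg hi, hx, hwrap hk hi]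
  · rw [Finsupp.notMem_support_iff.1 (mt (@(mem_firstStrings.1 hg).1 i) hi),
      Finsupp.notMem_support_iff.1 (mt (@(mem_firstStrings.1 hk).1 i) hi)]

lemma eq_zero_of_ringOp_eq_zero (ha : HasRange r a) (hta : TransInv a) (h0 : a 0 = 0)
    (hr : 2 * r ≤ N + 1) (h : ringOp N a = 0) : a = 0 := by
  have hfirst (k : Str d) (hk : k ∈ firstStrings d N) : a k = 0 := by
    by_contra hak
    have hsymbol := congrArg (symbol (wrap N k)) h
    simp only [ringOp, h0, zero_smul, zero_add, map_sum, map_smul, orbitSum, symbol_mon,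
      map_zero] at hsymbol
    have horbit {g : Str d} (hg : g ∈ firstStrings d N) :
        a g • ∑ x, (if wrap N k = translate x (wrap N g) then (1 : ℂ) else 0) =
          if k = g then a k else 0 := by
      by_cases hag : a g = 0
      · split_ifs with hkg
        · exact absurd (hkg ▸ hag) hak
        · rw [hag, zero_smul]
      simp only [eq_comm (a := wrap N k),
        translate_wrap_eq_wrap_iff hg hk (ha g hag) (ha k hak) hr]
      split_ifs with hkg
      · simp [hkg]
      · simp [Ne.symm hkg]
    rw [Finset.sum_congr rfl fun g hg => horbit hg, Finset.sum_ite_eq, if_pos hk] at hsymbol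
    exact hak hsymbol
  funext k
  by_contra hak
  have hk0 : k ≠ 0 := by rintro rfl; exact hak h0
  have hN : r ≤ N := by have := NeZero.one_le (n := N); omega
  exact hak (hta _ k ▸ hfirst _ (translate_mem_firstStrings hk0 ((ha k hak).mono hN)))

lemma lie_ringOp_orbitSum (ha : HasRange n a) (hta : TransInv a) {h : Str d} (hh : FitsIn m h)
    (hnm : n + m ≤ N + 1) : ⁅ringOp N a, orbitSum (wrap N h)⁆ =
      ∑ᶠ g, (a g * lam g h) • orbitSum (wrap N (g + h)) := by
  have hpair (g : Str d) : a g • ⁅orbitSum (wrap N g), orbitSum (wrap N h)⁆ =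
      ∑ᶠ t : ℤ, (a (translate t g) * lam (translate t g) h) •
        orbitSum (wrap N (translate t g + h)) := by
    simp only [hta _ g, mul_smul, ← smul_finsum]
    by_cases hg : a g = 0
    · rw [hg, zero_smul, zero_smul]
    rw [lie_orbitSum, sum_lam_wrap_smul (ha g hg) hh hnm fun x =>
      orbitSum (translate x (wrap N g) + wrap N h)]
    simp only [wrap_add, wrap_translate]
  rw [finsum_eq_sum_firstStrings (N := N) h fun g hg => ?_]
  · simp only [ringOp, add_lie, smul_lie, sum_lie, hpair]
    rw [Ring.lie_def, one_mul, mul_one, sub_self, smul_zero, zero_add]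
  · have hag := left_ne_zero_of_smul hg
    obtain ⟨i, hgi, hhi⟩ := exists_of_lam_ne_zero (right_ne_zero_of_mul hag)
    have hi := Finsupp.mem_support_iff.2 hhi
    have := hh i hi i hi
    exact ⟨(ha g (left_ne_zero_of_mul hag)).mono (by omega), i, hgi, hhi⟩

lemma lie_ringOp (ha : HasRange n a) (hb : HasRange m b) (hta : TransInv a) (htb : TransInv b)
    (hnm : n + m ≤ N + 1) : ⁅ringOp N a, ringOp N b⁆ = ringOp N (brk a b) := by
  let P (k h : Str d) : Op d (ZMod N) :=
    (lam (k - h) h * (a (k - h) * b h)) • orbitSum (wrap N k)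
  have hP (t : ℤ) (k h : Str d) : P (translate t k) (translate t h) = P k h := by
    simp only [P, ← map_sub, lam_translate, hta t, htb t, wrap_translate, orbitSum_translate]
  have hleft (h : Str d) : b h • ⁅ringOp N a, orbitSum (wrap N h)⁆ = ∑ᶠ k, P k h := by
    by_cases hbh : b h = 0
    · simp only [P, hbh, mul_zero, zero_smul, finsum_zero]
    rw [lie_ringOp_orbitSum ha hta (hb h hbh) hnm, smul_finsum,
      ← finsum_comp_equiv (Equiv.subRight h)]
    refine finsum_congr fun k => ?_
    rw [Equiv.subRight_apply, sub_add_cancel, smul_smul]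
    congr 1
    ring
  have hright (k : Str d) : brk a b k • orbitSum (wrap N k) = ∑ᶠ h, P k h := by
    rw [brk, finsum_smul, ← finsum_comp_equiv (Equiv.subLeft k)]
    simp only [P, Equiv.subLeft_apply, sub_sub_cancel]
  have hone : ⁅ringOp N a, (1 : Op d (ZMod N))⁆ = 0 := by
    rw [Ring.lie_def, mul_one, one_mul, sub_self]
  calc ⁅ringOp N a, ringOp N b⁆
    _ = ∑ h ∈ firstStrings d N, ∑ᶠ k, P k h := by
        rw [ringOp.eq_def N b, lie_add, lie_smul, hone, smul_zero, zero_add, lie_sum]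
        simp only [lie_smul, hleft]
    _ = ∑ k ∈ firstStrings d N, ∑ᶠ h, P k h := sum_firstStrings_finsum_comm hP fun k h hkh =>
          ha.fitsIn_of_brk_summand_ne_zero hb hnm (left_ne_zero_of_smul hkh)
    _ = ringOp N (brk a b) := by
        simp only [ringOp, brk_zero_apply, zero_smul, zero_add, hright]

end RingOp

section Hermitian

variable {d N : ℕ} [NeZero N]

lemma conjTranspose_transport {S T : Type} (f : S → T) (X : Op d S) :
    (transport f X).conjTranspose = transport f X.conjTranspose := by
  ext σ τ
  have hcomm : (∀ t ∉ Set.range f, τ t = σ t) ↔ ∀ t ∉ Set.range f, σ t = τ t :=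
    forall₂_congr fun _ _ => eq_comm
  simp only [Matrix.conjTranspose_apply, transport, apply_ite star, star_zero]
  by_cases hστ : ∀ t ∉ Set.range f, σ t = τ t
  · rw [if_pos hστ, if_pos (hcomm.2 hστ)]
  · rw [if_neg hστ, if_neg (mt hcomm.1 hστ)]

lemma FormalOp.isHermitian_finiteSize {Φ : FormalOp d} (hΦ : Φ.IsSelfAdjoint) :
    (Φ.finiteSize N).IsHermitian := by
  simp only [Matrix.IsHermitian, finiteSize, Matrix.conjTranspose_add,
    Matrix.conjTranspose_sum, conjTranspose_transport, (hΦ _).eq]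

open ComplexOrder in
lemma lie_eq_zero_of_lie_lie_eq_zero {ι : Type*} [Fintype ι] [DecidableEq ι]
    {A X : Matrix ι ι ℂ} (hA : A.IsHermitian) (h : ⁅A, ⁅A, X⁆⁆ = 0) : ⁅A, X⁆ = 0 := by
  rw [← Matrix.trace_conjTranspose_mul_self_eq_zero_iff]
  set Y := ⁅A, X⁆ with hY
  have hcomm : A * Y = Y * A := sub_eq_zero.1 h
  have hstar : Y.conjTranspose = X.conjTranspose * A - A * X.conjTranspose := by
    rw [hY, Ring.lie_def, Matrix.conjTranspose_sub, Matrix.conjTranspose_mul,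
      Matrix.conjTranspose_mul, hA]
  rw [hstar, sub_mul, Matrix.trace_sub, mul_assoc, mul_assoc, Matrix.trace_mul_comm A, mul_assoc,
    hcomm, sub_self]

variable [NeZero d] {n m : ℕ} {a b q : Str d → ℂ}

lemma TransInv.brk (ha : TransInv a) (hb : TransInv b) : TransInv (brk a b) := by
  intro x k
  simp only [brk_translate, ha x, hb x]

lemma ringOp_zero : ringOp N (0 : Str d → ℂ) = 0 := by
  simp [ringOp]

lemma FormalOp.brk_eq_zero_of_brk_brk {H : FormalOp d} (hH : H.IsSelfAdjoint)
    (hr : HasRange n H.coef) (ht : TransInv H.coef) (hqr : HasRange m q) (hqt : TransInv q)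
    (h : brk H.coef (brk H.coef q) = 0) : brk H.coef q = 0 := by
  let N := 2 * (n + m) + 1
  have hlie : ⁅H.finiteSize N, ringOp N q⁆ = ringOp N (brk H.coef q) := by
    rw [finiteSize_eq_ringOp, lie_ringOp hr hqr ht hqt (by omega)]
  have hlie₂ : ⁅H.finiteSize N, ⁅H.finiteSize N, ringOp N q⁆⁆ = 0 := by
    rw [hlie, finiteSize_eq_ringOp, lie_ringOp hr (hr.brk hqr) ht (ht.brk hqt) (by omega), h,
      ringOp_zero]
  refine eq_zero_of_ringOp_eq_zero (N := N) (hr.brk hqr) (ht.brk hqt) (brk_zero_apply _ _)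
    (by omega) ?_
  rw [← hlie]
  exact lie_eq_zero_of_lie_lie_eq_zero (isHermitian_finiteSize hH) hlie₂

end Hermitian

namespace FormalOp

variable {d : ℕ} [NeZero d] {H C : FormalOp d}

lemma coef_boost (H C : FormalOp d) :
    (boost H C).coef = (fun k => (leftmost k : ℂ) * H.coef k) + C.coef := by
  funext k
  rw [Pi.add_apply, coef, boost, map_add, map_smul, smul_eq_mul, leftmost]
  congr 2
  split_ifs <;> simp

lemma IsNearestNeighbor.hasRange_coef (hH : H.IsNearestNeighbor) : HasRange 2 H.coef := by
  refine hasRange_coef_iff.2 fun A hA => ?_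
  rw [setRange]
  split_ifs with hne
  · have hmin := A.min'_mem hne
    have hmax := A.max'_mem hne
    obtain ⟨i, rfl | rfl⟩ := hH A hA <;>
    · simp only [Finset.mem_insert, Finset.mem_singleton] at hmin hmax
      omega
  · exact zero_le

lemma IsNearestNeighbor.coef_zero (hH : H.IsNearestNeighbor) : H.coef 0 = 0 := by
  by_contra hne
  obtain ⟨i, hi | hi⟩ := hH _ fun hterm => hne (by rw [coef, hterm, map_zero])
  · simp at hi
  · exact Finset.insert_ne_empty i _ hi.symm

lemma IsOneLocal.hasRange_coef (hC : C.IsOneLocal) : HasRange 1 C.coef := hasRange_coef_iff.2 hC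

lemma hasRange_leftmost_mul {r : ℕ} {a : Str d → ℂ} (ha : HasRange r a) :
    HasRange r fun k => leftmost k * a k :=
  fun k hk => ha k (right_ne_zero_of_mul hk)

lemma hasRange_boost (hH : H.IsNearestNeighbor) (hC : C.IsOneLocal) :
    HasRange 2 (boost H C).coef := by
  rw [coef_boost]
  exact (hasRange_leftmost_mul hH.hasRange_coef).add (hC.hasRange_coef.mono one_le_two)

lemma hasRange_brk_brk_boost (hH : H.IsNearestNeighbor) (hC : C.IsOneLocal) :
    HasRange 3 (brk H.coef (brk (boost H C).coef H.coef)) := by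
  have hr := hH.hasRange_coef
  rw [coef_boost, add_brk _ _ hr, brk_add hr]
  exact hr.brk_brk_leftmost_mul.add (hr.brk (hC.hasRange_coef.brk hr))

lemma coef_boost_translate (hH : H.IsNearestNeighbor) (ht : TransInv H.coef)
    (hCt : TransInv C.coef) (x : ℤ) (k : Str d) :
    (boost H C).coef (translate x k) = (boost H C).coef k + x * H.coef k := by
  simp only [coef_boost, Pi.add_apply, ht x k, hCt x k]
  by_cases hk : k = 0
  · simp [hk, hH.coef_zero]
  · rw [leftmost_translate x hk, Int.cast_add]
    ring

lemma transInv_brk_boost (hH : H.IsNearestNeighbor) (ht : TransInv H.coef) (hC : C.IsOneLocal)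
    (hCt : TransInv C.coef) {m : ℕ} {q : Str d → ℂ} (hqr : HasRange m q) (hqt : TransInv q)
    (hq : brk H.coef q = 0) : TransInv (brk (boost H C).coef q) := by
  let h : finiteRange d := ⟨H.coef, 2, hH.hasRange_coef⟩
  let b : finiteRange d := ⟨(boost H C).coef, 2, hasRange_boost hH hC⟩
  let q' : finiteRange d := ⟨q, m, hqr⟩
  have hlie : ⁅h, q'⁆ = 0 := Subtype.ext hq
  intro x k
  have hshift : (fun g => (boost H C).coef (translate x g)) = (b + x • h : finiteRange d).1 := by
    funext g
    simpa [b, h] using coef_boost_translate hH ht hCt x g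
  calc brk (boost H C).coef q (translate x k)
    _ = (⁅b + x • h, q'⁆ : finiteRange d).1 k := by
        simp only [brk_translate, hshift, hqt x, finiteRange.coe_lie, q']
    _ = brk (boost H C).coef q k := by
        rw [add_lie, smul_lie, hlie, smul_zero, add_zero, finiteRange.coe_lie]

lemma coef_charge_succ (hH : H.IsNearestNeighbor) (hC : C.IsOneLocal) (n : ℕ) :
    (H.charge C (n + 3)).coef = brk (boost H C).coef (H.charge C (n + 2)).coef := by
  rw [← coef_comm (hasRange_boost hH hC)]
  exact congrArg coef (Function.iterate_succ_apply' _ n H)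

lemma hasRange_charge (hH : H.IsNearestNeighbor) (hC : C.IsOneLocal) (n : ℕ) :
    HasRange (n + 2) (H.charge C (n + 2)).coef := by
  induction n with
  | zero => exact hH.hasRange_coef
  | succ n ih =>
    rw [coef_charge_succ hH hC]
    exact ((hasRange_boost hH hC).brk ih).mono (by omega)

lemma transInv_charge_and_brk_eq_zero (hH : H.IsNearestNeighbor) (hHs : H.IsSelfAdjoint)
    (ht : TransInv H.coef) (hC : C.IsOneLocal) (hCt : TransInv C.coef)
    (hcons : brk H.coef (brk (boost H C).coef H.coef) = 0) (n : ℕ) :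
    TransInv (H.charge C (n + 2)).coef ∧ brk H.coef (H.charge C (n + 2)).coef = 0 := by
  let h : finiteRange d := ⟨H.coef, 2, hH.hasRange_coef⟩
  let b : finiteRange d := ⟨(boost H C).coef, 2, hasRange_boost hH hC⟩
  induction n with
  | zero => exact ⟨ht, congrArg Subtype.val (lie_self h)⟩
  | succ n ih =>
    obtain ⟨hqt, hq⟩ := ih
    let q : finiteRange d := ⟨(H.charge C (n + 2)).coef, n + 2, hasRange_charge hH hC n⟩
    have hdouble : ⁅h, ⁅h, ⁅b, q⁆⁆⁆ = 0 :=
      lie_lie_lie_eq_zero (Subtype.ext hq) (Subtype.ext hcons)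
    rw [coef_charge_succ hH hC]
    have htrans := transInv_brk_boost hH ht hC hCt (hasRange_charge hH hC n) hqt hq
    exact ⟨htrans, brk_eq_zero_of_brk_brk hHs hH.hasRange_coef ht
      ((hasRange_boost hH hC).brk (hasRange_charge hH hC n)) htrans (congrArg Subtype.val hdouble)⟩

lemma brk_charge_eq_zero (hH : H.IsNearestNeighbor) (hC : C.IsOneLocal)
    (h0 : ∀ n, brk H.coef (H.charge C (n + 2)).coef = 0) (n m : ℕ) :
    brk (H.charge C (n + 2)).coef (H.charge C (m + 2)).coef = 0 := by
  let b : finiteRange d := ⟨(boost H C).coef, 2, hasRange_boost hH hC⟩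
  let Q (n : ℕ) : finiteRange d := ⟨(H.charge C (n + 2)).coef, n + 2, hasRange_charge hH hC n⟩
  have hQ (n : ℕ) : Q (n + 1) = ⁅b, Q n⁆ := Subtype.ext (coef_charge_succ hH hC n)
  exact congrArg Subtype.val
    (lie_eq_zero_of_forall_lie_zero hQ (fun n => Subtype.ext (h0 n)) n m)

lemma brk_brk_boost_eq_zero {N : ℕ} [NeZero N] (hN : 5 ≤ N) (hH : H.IsNearestNeighbor)
    (ht : TransInv H.coef) (hC : C.IsOneLocal) (hCt : TransInv C.coef)
    (hcons : ⁅H.finiteSize N, (H.charge C 3).finiteSize N⁆ = 0) :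
    brk H.coef (brk (boost H C).coef H.coef) = 0 := by
  have hr := hH.hasRange_coef
  have hself : brk H.coef H.coef = 0 := self_eq_neg.1 (brk_swap H.coef H.coef)
  have hQt := transInv_brk_boost hH ht hC hCt hr ht hself
  have hQr : HasRange 3 (brk (boost H C).coef H.coef) := (hasRange_boost hH hC).brk hr
  have hQ : (H.charge C 3).coef = brk (boost H C).coef H.coef := coef_charge_succ hH hC 0
  rw [finiteSize_eq_ringOp, finiteSize_eq_ringOp, hQ,
    lie_ringOp hr hQr ht hQt (by omega)] at hcons
  exact eq_zero_of_ringOp_eq_zero (hasRange_brk_brk_boost hH hC) (ht.brk hQt)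
    (brk_zero_apply _ _) (by omega) hcons

end FormalOp

end SpinChain

open SpinChain FormalOp in
theorem corollary1_general (d : ℕ) [NeZero d] (H C : FormalOp d)
    (hH_nn : H.IsNearestNeighbor) (hH_sa : H.IsSelfAdjoint) (hH_inv : H.IsTranslationInvariant)
    (hC_one : C.IsOneLocal) (hC_inv : C.IsTranslationInvariant)
    (N₀ : ℕ) [NeZero N₀] (hN₀ : 5 ≤ N₀)
    (hcons : ⁅H.finiteSize N₀, (H.charge C 3).finiteSize N₀⁆ = 0) :
    (∀ n : ℕ, 2 ≤ n → (H.charge C n).IsTranslationInvariant) ∧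
    (∀ (N : ℕ) [NeZero N] (n m : ℕ), 2 ≤ n → 2 ≤ m → n + m ≤ N + 1 →
      ⁅(H.charge C n).finiteSize N, (H.charge C m).finiteSize N⁆ = 0) := by
  have ht := isTranslationInvariant_iff.1 hH_inv
  have hCt := isTranslationInvariant_iff.1 hC_inv
  have hQ₃ := brk_brk_boost_eq_zero hN₀ hH_nn ht hC_one hCt hcons
  have hQ := transInv_charge_and_brk_eq_zero hH_nn hH_sa ht hC_one hCt hQ₃
  refine ⟨fun n hn => ?_, fun N _ n m hn hm hnm => ?_⟩
  · obtain ⟨n, rfl⟩ := Nat.exists_eq_add_of_le' hn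
    exact isTranslationInvariant_iff.2 (hQ n).1
  · obtain ⟨n, rfl⟩ := Nat.exists_eq_add_of_le' hn
    obtain ⟨m, rfl⟩ := Nat.exists_eq_add_of_le' hm
    rw [finiteSize_eq_ringOp, finiteSize_eq_ringOp,
      lie_ringOp (hasRange_charge hH_nn hC_one n) (hasRange_charge hH_nn hC_one m) (hQ n).1
        (hQ m).1 hnm,
      brk_charge_eq_zero hH_nn hC_one (fun n => (hQ n).2), ringOp_zero]

theorem corollary1 (d : ℕ) (hd : 0 < d) (H C : SpinChain.FormalOp d)
    (hH_nn : H.IsNearestNeighbor) (hH_sa : H.IsSelfAdjoint) (hH_inv : H.IsTranslationInvariant)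
    (hC_one : C.IsOneLocal) (hC_inv : C.IsTranslationInvariant)
    (N₀ : ℕ) [NeZero N₀] (hN₀ : 6 ≤ N₀)
    (hcons : ⁅H.finiteSize N₀, (H.charge C 3).finiteSize N₀⁆ = 0) :
    (∀ n : ℕ, 2 ≤ n → (H.charge C n).IsTranslationInvariant) ∧
    (∀ (N : ℕ) [NeZero N], 4 ≤ N → ∀ n m : ℕ, 2 ≤ n → 2 ≤ m → 2 * n ≤ N → 2 * m ≤ N →
      ⁅(H.charge C n).finiteSize N, (H.charge C m).finiteSize N⁆ = 0) ∧
    (∀ (N : ℕ) [NeZero N], 4 ≤ N → ∀ n : ℕ, 2 ≤ n → 2 * n ≤ N →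
      ⁅H.finiteSize N, (H.charge C n).finiteSize N⁆ = 0) := by
  have : NeZero d := ⟨hd.ne'⟩
  obtain ⟨hinv, hcomm⟩ :=
    corollary1_general d H C hH_nn hH_sa hH_inv hC_one hC_inv N₀ (by omega) hcons
  exact ⟨hinv, fun N _ _ n m hn hm hnN hmN => hcomm N n m hn hm (by omega),
    fun N _ _ n hn hnN => hcomm N 2 n le_rfl hn (by omega)⟩
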